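/- Let $R$ be a commutative noetherian ring, $J\subset R$ an ideal, and $\mathcal C$ a noetherian $R$-linear abelian category (i.e. $\mathcal C$ is essentially small and all its objects are noetherian). For an object $M$ of an $R$-linear category, $M/MJ^n=M\otimes_R R/J^n$ denotes the universal quotient of $M$ annihilated by $J^n$. The ($J$-adic) completion $\widehat{\mathcal C}$ of $\mathcal C$ is the full subcategory of the category $\operatorname{Pro}(\mathcal C)$ of pro-objects over $\mathcal C$ consisting of the pro-objects $M$ such that $M/MJ^n\in\mathcal C$ for all $n$ and such that the canonical map $M\to\varprojlim_n M/MJ^n$ is an isomorphism. A noetherian $R$-linear abelian category $\mathcal D$ is called complete if the canonical functor $\Phi:\mathcal D\to\widehat{\mathcal D}$, $M\mapsto\varprojlim_n M/MJ^n$ (limit taken in $\operatorname{Pro}(\mathcal D)$), is an equivalence. Then $\widehat{\mathcal C}$ is complete; that is, $\widehat{\mathcal C}$ is a noetherian $R$-linear abelian category, and its canonical functor $\Phi:\widehat{\mathcal C}\to\widehat{\widehat{\mathcal C}}$ is well defined and an equivalence. -/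

import Mathlib

open CategoryTheory Limits Opposite

universe w v u

noncomputable section

namespace AdicCompletionCat

/-! ### The preadditive structure on ind-objects of a preadditive category -/

section IndPreadditive

variable (D : Type u) [Category.{v} D] [Preadditive D]

/-- Additive presheaves of abelian groups whose underlying presheaf of sets is an ind-object. -/
def IndAb : ObjectProperty (Dᵒᵖ ⥤ AddCommGrpCat.{v}) :=
  fun P => P.Additive ∧ IsIndObject (P ⋙ forget AddCommGrpCat.{v})

/-- Forgetting the group structure. -/
def indAbForget : (IndAb D).FullSubcategory ⥤
    ObjectProperty.FullSubcategory (IsIndObject (C := D)) :=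
  ObjectProperty.lift _ ((IndAb D).ι ⋙ (Functor.whiskeringRight _ _ _).obj (forget _))
    (fun P => P.property.2)

variable {D}

theorem IsIndObject.exists_common {D : Type u} [Category.{v} D] {P : Dᵒᵖ ⥤ Type v} (hP : IsIndObject P) {X : D}
    (p q : P.obj (op X)) :
    ∃ (Y : D) (e : P.obj (op Y)) (f g : X ⟶ Y), P.map f.op e = p ∧ P.map g.op e = q := by
  have := hP.isFiltered
  let a : CostructuredArrow yoneda P := CostructuredArrow.mk (yonedaEquiv.symm p)
  let b : CostructuredArrow yoneda P := CostructuredArrow.mk (yonedaEquiv.symm q)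
  let c := IsFiltered.max a b
  refine ⟨c.left, yonedaEquiv c.hom, (IsFiltered.leftToMax a b).left,
    (IsFiltered.rightToMax a b).left, ?_, ?_⟩
  · rw [yonedaEquiv_naturality]
    have := CostructuredArrow.w (IsFiltered.leftToMax a b)
    rw [show yoneda.map _ ≫ c.hom = _ from this]
    exact yonedaEquiv.apply_symm_apply _
  · rw [yonedaEquiv_naturality]
    have := CostructuredArrow.w (IsFiltered.rightToMax a b)
    rw [show yoneda.map _ ≫ c.hom = _ from this]
    exact yonedaEquiv.apply_symm_apply _

instance : (indAbForget D).Faithful where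
  map_injective {P Q} f g h := by
    ext X x
    have := congrArg (fun k => k.hom.app X x) h
    exact this

theorem map_add_of_isIndObject {P Q : Dᵒᵖ ⥤ AddCommGrpCat.{v}} [P.Additive] [Q.Additive]
    (hP : IsIndObject (P ⋙ forget AddCommGrpCat.{v}))
    (α : P ⋙ forget _ ⟶ Q ⋙ forget _) (X : Dᵒᵖ) (x y : P.obj X) :
    (α.app X (x + y : P.obj X) : Q.obj X) = (α.app X x : Q.obj X) + (α.app X y : Q.obj X) := by
  obtain ⟨Y, e, f, g, hf, hg⟩ := IsIndObject.exists_common hP (X := X.unop) x y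
  have key : ∀ h : X.unop ⟶ Y, (α.app X (P.map h.op e : P.obj X) : Q.obj X) =
      Q.map h.op (α.app (op Y) e) := fun h => by
    have := congrArg (fun k => k e) (α.naturality h.op)
    exact this
  have hadd : (P.map (f + g).op e : P.obj X) = x + y := by
    rw [op_add, P.map_add, ← hf, ← hg]
    rfl
  have h1 := key (f + g)
  rw [hadd, op_add, Q.map_add] at h1
  have h2 := key f
  have h3 := key g
  have hf' : P.map f.op e = x := hf
  have hg' : P.map g.op e = y := hg
  rw [hf'] at h2
  rw [hg'] at h3
  rw [h1, h2, h3]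
  rfl

instance : (indAbForget D).Full where
  map_surjective {P Q} α := by
    have := P.property.1
    have : ((IndAb D).ι.obj Q).Additive := Q.property.1
    have : ((IndAb D).ι.obj P).Additive := P.property.1
    refine ⟨ObjectProperty.homMk
      { app := fun X => AddCommGrpCat.ofHom (AddMonoidHom.mk'
          (fun x : P.obj.obj X => (α.hom.app X x : Q.obj.obj X))
          (map_add_of_isIndObject P.property.2 α.hom X))
        naturality := fun X Y f => ?_ }, ?_⟩
    · ext x
      have := congrArg (fun k => k x) (α.hom.naturality f)
      exact this
    · rfl

/-- Adding the group structures of the representables is compatible with forgetting. -/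
def preadditiveYonedaForget : preadditiveYoneda (C := D) ⋙
    (Functor.whiskeringRight _ _ _).obj (forget AddCommGrpCat.{v}) ≅ yoneda :=
  Iso.refl _

theorem additive_of_isColimit {I : Type v} [SmallCategory I] (F : I ⥤ D)
    (c : Cocone (F ⋙ preadditiveYoneda)) (hc : IsColimit c) : c.pt.Additive where
  map_add {X Y f g} := by
    have h := isColimitOfPreserves ((evaluation Dᵒᵖ AddCommGrpCat.{v}).obj X) hc
    refine h.hom_ext fun i => ?_
    have nat : ∀ k : X ⟶ Y, (c.ι.app i).app X ≫ c.pt.map k =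
        (preadditiveYoneda.obj (F.obj i)).map k ≫ (c.ι.app i).app Y :=
      fun k => ((c.ι.app i).naturality k).symm
    change (c.ι.app i).app X ≫ c.pt.map (f + g) = (c.ι.app i).app X ≫ (c.pt.map f + c.pt.map g)
    rw [nat, Preadditive.comp_add, nat, nat, Functor.map_add, Preadditive.add_comp]

instance : (indAbForget D).EssSurj where
  mem_essImage P := by
    let p := P.property.presentation
    let c := colimit.cocone (p.F ⋙ preadditiveYoneda)
    let hc : IsColimit c := colimit.isColimit _
    let U := (Functor.whiskeringRight Dᵒᵖ _ _).obj (forget AddCommGrpCat.{v})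
    have hU : IsColimit (U.mapCocone c) := isColimitOfPreserves U hc
    let e : U.obj c.pt ≅ P.obj := hU.coconePointUniqueUpToIso p.coconeIsColimit
    have hI : IsIndObject (U.obj c.pt) := IsIndObject.map e.inv P.property
    exact ⟨⟨c.pt, additive_of_isColimit p.F c hc, hI⟩, ⟨ObjectProperty.isoMk _ e⟩⟩

instance : (indAbForget D).IsEquivalence where

variable (D)

/-- The fully faithful embedding of ind-objects into presheaves of abelian groups. -/
def indToAb : Ind D ⥤ Dᵒᵖ ⥤ AddCommGrpCat.{v} :=
  (Ind.equivalence D).functor ⋙ (indAbForget D).inv ⋙ (IndAb D).ι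

def indToAbFullyFaithful : (indToAb D).FullyFaithful :=
  ((Ind.equivalence D).fullyFaithfulFunctor.comp
    (Functor.FullyFaithful.ofFullyFaithful (indAbForget D).inv)).comp
    (IndAb D).fullyFaithfulι

/-- The underlying presheaf of sets is unchanged. -/
def indToAbForget : indToAb D ⋙ (Functor.whiskeringRight _ _ _).obj (forget AddCommGrpCat.{v}) ≅
    Ind.inclusion D :=
  Functor.isoWhiskerLeft (Ind.equivalence D).functor
    (Functor.isoWhiskerRight (indAbForget D).asEquivalence.counitIso
      (ObjectProperty.ι (IsIndObject (C := D))))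

instance (M : Ind D) : ((indToAb D).obj M).Additive :=
  ((indAbForget D).inv.obj ((Ind.equivalence D).functor.obj M)).property.1

end IndPreadditive

/-! ### Pro-objects -/

section ProObjects

variable (R : Type w) [CommRing R] (C : Type u) [Category.{v} C]

/-- The category of pro-objects of `C`, the opposite of the category of ind-objects of `Cᵒᵖ`. -/
def Pro : Type (max u (v + 1)) := (Ind Cᵒᵖ)ᵒᵖ

instance : Category.{v} (Pro C) := inferInstanceAs (Category.{v} (Ind Cᵒᵖ)ᵒᵖ)

/-- Objects of `C`, seen as constant pro-objects. -/
def Pro.const : C ⥤ Pro C := (Ind.yoneda (C := Cᵒᵖ)).rightOp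

instance : HasLimitsOfShape ℕᵒᵖ (Pro C) :=
  have : HasFilteredColimitsOfSize.{0, 0} (Ind Cᵒᵖ) :=
    hasFilteredColimitsOfSize_shrink.{0, 0, v, v}
  inferInstanceAs (HasLimitsOfShape ℕᵒᵖ (Ind Cᵒᵖ)ᵒᵖ)

variable [Preadditive C]

/-- The contravariant fully faithful embedding of pro-objects into copresheaves of abelian
groups, sending `(M_α)` to `colim_α Hom(M_α, -)`. -/
def proToAb : Pro C ⥤ (Cᵒᵖᵒᵖ ⥤ AddCommGrpCat.{v})ᵒᵖ := (indToAb Cᵒᵖ).op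

def proToAbFullyFaithful : (proToAb C).FullyFaithful := (indToAbFullyFaithful Cᵒᵖ).op

instance : Preadditive (Pro C) := Preadditive.ofFullyFaithful (proToAbFullyFaithful C)

instance : (proToAb C).Additive := (proToAbFullyFaithful C).additive_ofFullyFaithful

instance (M : Pro C) : ((proToAb C).obj M).unop.Additive :=
  inferInstanceAs ((indToAb Cᵒᵖ).obj _).Additive

variable {R C}
variable [Linear R C]

/-- The action of a scalar on a copresheaf, induced by functoriality. -/
def copresheafSMul (r : R) (P : Cᵒᵖᵒᵖ ⥤ AddCommGrpCat.{v}) : P ⟶ P where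
  app X := P.map (r • 𝟙 X.unop.unop).op.op
  naturality X Y f := by
    rw [← P.map_comp, ← P.map_comp]
    congr 1
    apply Quiver.Hom.unop_inj
    apply Quiver.Hom.unop_inj
    simp

variable (R)

/-- The action of a scalar on a pro-object: on `(M_α)` it is given by the action on each `M_α`. -/
def proSMul (r : R) (M : Pro C) : M ⟶ M :=
  (proToAbFullyFaithful C).preimage (copresheafSMul r ((proToAb C).obj M).unop).op

theorem proToAb_map_proSMul (r : R) (M : Pro C) :
    (proToAb C).map (proSMul R r M) = (copresheafSMul r ((proToAb C).obj M).unop).op :=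
  (proToAbFullyFaithful C).map_preimage _

theorem proSMul_naturality (r : R) {M N : Pro C} (f : M ⟶ N) :
    proSMul R r M ≫ f = f ≫ proSMul R r N := by
  apply (proToAbFullyFaithful C).map_injective
  rw [Functor.map_comp, Functor.map_comp, proToAb_map_proSMul, proToAb_map_proSMul]
  apply Quiver.Hom.unop_inj
  ext X : 2
  exact (((proToAb C).map f).unop.naturality (r • 𝟙 X.unop.unop).op.op).symm

theorem proSMul_add (r s : R) (M : Pro C) :
    proSMul R (r + s) M = proSMul R r M + proSMul R s M := by
  apply (proToAbFullyFaithful C).map_injective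
  rw [Functor.map_add]
  simp only [proToAb_map_proSMul]
  apply Quiver.Hom.unop_inj
  ext X : 2
  change ((proToAb C).obj M).unop.map _ = ((proToAb C).obj M).unop.map _ +
    ((proToAb C).obj M).unop.map _
  rw [← Functor.map_add, add_smul]
  rfl

theorem proSMul_mul (r s : R) (M : Pro C) :
    proSMul R (r * s) M = proSMul R r M ≫ proSMul R s M := by
  apply (proToAbFullyFaithful C).map_injective
  rw [Functor.map_comp]
  simp only [proToAb_map_proSMul]
  apply Quiver.Hom.unop_inj
  ext X : 2
  change ((proToAb C).obj M).unop.map _ = ((proToAb C).obj M).unop.map _ ≫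
    ((proToAb C).obj M).unop.map _
  rw [← Functor.map_comp]
  congr 1
  apply Quiver.Hom.unop_inj
  apply Quiver.Hom.unop_inj
  simp [mul_smul]

theorem proSMul_one (M : Pro C) : proSMul R 1 M = 𝟙 M := by
  apply (proToAbFullyFaithful C).map_injective
  rw [proToAb_map_proSMul, CategoryTheory.Functor.map_id]
  apply Quiver.Hom.unop_inj
  ext X : 2
  change ((proToAb C).obj M).unop.map _ = 𝟙 _
  rw [one_smul]
  exact ((proToAb C).obj M).unop.map_id _

theorem proSMul_zero (M : Pro C) : proSMul R 0 M = 0 := by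
  have h := proSMul_add R 0 0 M
  rwa [add_zero, left_eq_add] at h

instance : Linear R (Pro C) where
  homModule M N :=
    { smul := fun r f => proSMul R r M ≫ f
      one_smul := fun f => by
        change proSMul R 1 M ≫ f = f
        rw [proSMul_one, Category.id_comp]
      mul_smul := fun r s f => by
        change proSMul R (r * s) M ≫ f = proSMul R r M ≫ proSMul R s M ≫ f
        rw [proSMul_mul, Category.assoc]
      smul_zero := fun r => by
        change proSMul R r M ≫ (0 : M ⟶ N) = 0
        rw [comp_zero]
      smul_add := fun r f g => by
        change proSMul R r M ≫ (f + g) = proSMul R r M ≫ f + proSMul R r M ≫ g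
        rw [Preadditive.comp_add]
      add_smul := fun r s f => by
        change proSMul R (r + s) M ≫ f = proSMul R r M ≫ f + proSMul R s M ≫ f
        rw [proSMul_add, Preadditive.add_comp]
      zero_smul := fun f => by
        change proSMul R 0 M ≫ f = 0
        rw [proSMul_zero, zero_comp] }
  smul_comp M N K r f g := by
    change (proSMul R r M ≫ f) ≫ g = proSMul R r M ≫ f ≫ g
    rw [Category.assoc]
  comp_smul M N K f r g := by
    change f ≫ proSMul R r N ≫ g = proSMul R r M ≫ f ≫ g
    rw [← Category.assoc, ← proSMul_naturality, Category.assoc]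

end ProObjects

/-! ### Reduction modulo an ideal -/

section Reduction

variable {R : Type w} [CommRing R]

/-- `π : M ⟶ Q` exhibits `Q` as `M / MI = M ⊗_R R/I`: it is the universal morphism out of `M`
killed by all elements of `I`, i.e. the cokernel of `MI = ∑_{r ∈ I} im (r : M ⟶ M)`. -/
structure IsReduction {D : Type u} [Category.{v} D] [Preadditive D] [Linear R D]
    (I : Ideal R) {M Q : D} (π : M ⟶ Q) : Prop where
  smul_eq_zero : ∀ r ∈ I, r • π = 0
  existsUnique_desc : ∀ ⦃X : D⦄ (f : M ⟶ X), (∀ r ∈ I, r • f = 0) → ∃! g : Q ⟶ X, π ≫ g = f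

variable (J : Ideal R) (D : Type u) [Category.{v} D] [Preadditive D] [Linear R D]

/-- All quotients `M / MJⁿ` exist in `D`. This is automatic if `D` is abelian and all powers of
`J` are finitely generated. -/
class HasReductions : Prop where
  exists_reduction : ∀ (n : ℕ) (M : D), ∃ (Q : D) (π : M ⟶ Q), IsReduction (J ^ n) π

variable {D} [HasReductions J D]

/-- The object `M / MJⁿ`. -/
def red (n : ℕ) (M : D) : D := (HasReductions.exists_reduction (J := J) n M).choose

/-- The quotient map `M ⟶ M / MJⁿ`. -/
def redπ (n : ℕ) (M : D) : M ⟶ red J n M :=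
  (HasReductions.exists_reduction (J := J) n M).choose_spec.choose

theorem isReduction_redπ (n : ℕ) (M : D) : IsReduction (J ^ n) (redπ J n M) :=
  (HasReductions.exists_reduction (J := J) n M).choose_spec.choose_spec

variable {J}

/-- The morphism out of `M / MJⁿ` induced by a morphism killed by `Jⁿ`. -/
def redDesc {n : ℕ} {M X : D} (f : M ⟶ X) (hf : ∀ r ∈ J ^ n, r • f = 0) : red J n M ⟶ X :=
  ((isReduction_redπ J n M).existsUnique_desc f hf).choose

theorem redπ_desc {n : ℕ} {M X : D} (f : M ⟶ X) (hf : ∀ r ∈ J ^ n, r • f = 0) :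
    redπ J n M ≫ redDesc f hf = f :=
  ((isReduction_redπ J n M).existsUnique_desc f hf).choose_spec.1

theorem red_hom_ext {n : ℕ} {M X : D} {f g : red J n M ⟶ X}
    (h : redπ J n M ≫ f = redπ J n M ≫ g) : f = g := by
  have hk : ∀ r ∈ J ^ n, r • (redπ J n M ≫ g) = 0 := fun r hr => by
    rw [← Linear.smul_comp, (isReduction_redπ J n M).smul_eq_zero r hr, zero_comp]
  exact ((isReduction_redπ J n M).existsUnique_desc _ hk).unique h rfl

/-- The morphism `M / MJⁿ ⟶ N / NJᵐ` induced by `f : M ⟶ N`, for `m ≤ n`. -/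
def redMap {n m : ℕ} (h : m ≤ n) {M N : D} (f : M ⟶ N) : red J n M ⟶ red J m N :=
  redDesc (f ≫ redπ J m N) fun r hr => by
    rw [← Linear.comp_smul, (isReduction_redπ J m N).smul_eq_zero r (Ideal.pow_le_pow_right h hr),
      comp_zero]

theorem redπ_map {n m : ℕ} (h : m ≤ n) {M N : D} (f : M ⟶ N) :
    redπ J n M ≫ redMap h f = f ≫ redπ J m N := redπ_desc _ _

theorem redMap_id (n : ℕ) (M : D) : redMap (J := J) le_rfl (𝟙 M) = 𝟙 (red J n M) :=
  red_hom_ext (by simp [redπ_map])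

theorem redMap_comp {n m l : ℕ} (h : m ≤ n) (h' : l ≤ m) {M N K : D} (f : M ⟶ N) (g : N ⟶ K) :
    redMap (J := J) h f ≫ redMap h' g = redMap (h'.trans h) (f ≫ g) :=
  red_hom_ext (by rw [← Category.assoc, redπ_map, Category.assoc, redπ_map, redπ_map,
    Category.assoc])

variable (J D)

/-- The functor sending `M` to the inverse system `⋯ ⟶ M / MJ² ⟶ M / MJ ⟶ M / MJ⁰ = 0`. -/
def redTower : D ⥤ ℕᵒᵖ ⥤ D where
  obj M :=
    { obj := fun n => red J n.unop M
      map := fun f => redMap (leOfHom f.unop) (𝟙 M)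
      map_id := fun _ => redMap_id _ _
      map_comp := fun _ _ => by rw [redMap_comp, Category.id_comp] }
  map f :=
    { app := fun n => redMap le_rfl f
      naturality := fun _ _ _ => by
        dsimp only
        rw [redMap_comp, redMap_comp, Category.id_comp, Category.comp_id] }
  map_id M := by
    ext n
    exact redMap_id _ _
  map_comp f g := by
    ext n
    exact (redMap_comp le_rfl le_rfl f g).symm

end Reduction

/-! ### The completion -/

section Completion

variable {R : Type w} [CommRing R] (J : Ideal R)
variable (C : Type u) [Category.{v} C] [Preadditive C] [Linear R C]

/-- A pro-object `M` over `C` lies in the completion if `M / MJⁿ` lies in `C` for all `n` and the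
canonical morphism `M ⟶ lim_n M / MJⁿ` is an isomorphism. (The transition morphisms of the inverse
system `T` below are determined by naturality of `π` and the universal property of `M / MJⁿ`.) -/
def isAdic : ObjectProperty (Pro C) := fun M =>
  ∃ (T : ℕᵒᵖ ⥤ Pro C) (π : (Functor.const ℕᵒᵖ).obj M ⟶ T),
    (∀ n : ℕ, IsReduction (J ^ n) (π.app (op n))) ∧
    (∀ n : ℕ, (Pro.const C).essImage (T.obj (op n))) ∧
    Nonempty (IsLimit (Cone.mk M π))

/-- The `J`-adic completion of the `R`-linear category `C`. -/
abbrev Completion : Type (max u (v + 1)) := (isAdic J C).FullSubcategory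

/-- The functor `M ↦ lim_n M / MJⁿ` from `C` to pro-objects over `C`. -/
def toPro [HasReductions J C] : C ⥤ Pro C :=
  redTower J C ⋙ (Functor.whiskeringRight ℕᵒᵖ C (Pro C)).obj (Pro.const C) ⋙ lim

/-- The preadditive category `C` is abelian. -/
def IsAbelian (C : Type u) [Category.{v} C] [inst : Preadditive C] : Prop :=
  ∃ a : Abelian C, a.toPreadditive = inst

/-- The `R`-linear category `C` is a complete noetherian abelian category: it is abelian and
noetherian, and the canonical functor `M ↦ lim_n M / MJⁿ` takes values in the completion and is an
equivalence from `C` to its completion. -/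
structure IsComplete : Prop where
  isAbelian : IsAbelian C
  noetherian : Noetherian.{v, u, v} C
  hasReductions : HasReductions J C
  isAdic_toPro : ∀ M : C, isAdic J C ((toPro J C).obj M)
  isEquivalence : (ObjectProperty.lift (isAdic J C) (toPro J C) isAdic_toPro).IsEquivalence

end Completion

end AdicCompletionCat

end

/-!
The completion `Ĉ` is compared with the category of *adic towers* over `C`: inverse systems
`⋯ ⟶ T₂ ⟶ T₁ ⟶ T₀` in `C` whose transition morphisms identify `Tₙ` with `Tₘ / TₘJⁿ` for `n ≤ m`.

**The completion is the category of adic towers.** A constant pro-object `Y` is cocompact: every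
morphism from `lim Tₙ` to `Y` comes from some `Tₙ`, and two morphisms from `Tₙ` that agree on the
limit agree on some `Tₘ`. Hence the quotient of `lim Tₙ` by `Jⁿ` is `Tₙ`
(`isAdicTower.isReduction_π`), and `T ↦ lim Tₙ` is an equivalence from adic towers to `Ĉ`
(`limTower`).

**The canonical functor.** As the same equivalence is available over any base, it is enough to see
that `M ↦ (M / MJⁿ)ₙ` is an equivalence from `Ĉ` to adic towers over `Ĉ` (`toAdicTower`). It is
fully faithful because objects of `Ĉ` are the limits of their reductions. It is essentially
surjective because an object of `Ĉ` killed by some `Jⁿ` is constant, so that an adic tower over `Ĉ` is one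
over `C`. This part is formal and only uses that the quotients `M / MJⁿ` exist in `C`.

**Adic towers are abelian and noetherian.** By the Freyd–Mitchell theorem there is a faithful exact
`R`-linear functor from `C` to modules, so that one can argue with elements and submodules. For an
adic tower `N`, generators of `J` act on the associated graded object `⨁ ker (Nᵢ₊₁ ⟶ Nᵢ)` by
operators of degree one, and this object is generated in degree zero. The argument of
Hilbert's basis theorem, with iterated quotients by one operator in place of leading coefficients,
gives the ascending chain condition for its graded subobjects
(`IsGradedSub.exists_forall_eq_of_monotone`). Two consequences follow.
* Towers of subobjects `U ⊆ N` with surjective transition morphisms satisfy the ascending chain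
  condition (`exists_forall_eq_of_monotone_subtower`).
* The Artin–Rees lemma holds for them (`IsSubtower.exists_ker_le`): for some `d`, an element of
  `Uₘ` that dies in `U_{d+n}` lies in `UₘJⁿ`. Hence the tower with terms `U_{d+n} / U_{d+n}Jⁿ` is
  adic, and it is the universal adic tower over `N` with values in `U` (`exists_adicSub`).

Cokernels of adic towers are formed degreewise. The construction of `exists_adicSub` factors every
morphism as a degreewise epimorphism followed by a monomorphism, and provides the kernels of
degreewise epimorphisms; so kernels exist, and monomorphisms and epimorphisms are normal.
-/

noncomputable section

namespace AdicCompletionCat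

/-! ### Morphisms of ind-objects and pro-objects -/

section IndHom

variable {D : Type u} [Category.{v} D]

/-- Morphisms from a representable ind-object to `X` are the elements of the presheaf `X`. -/
def indHomEquiv (A : D) (X : Ind D) :
    (Ind.yoneda.obj A ⟶ X) ≃ ((Ind.inclusion D).obj X).obj (op A) :=
  Ind.inclusion.fullyFaithful.homEquiv.trans
    (((Ind.yonedaCompInclusion.app A).homCongr (Iso.refl _)).trans yonedaEquiv)

theorem indHomEquiv_comp {A : D} {X Y : Ind D} (x : Ind.yoneda.obj A ⟶ X) (f : X ⟶ Y) :
    indHomEquiv A Y (x ≫ f) = ((Ind.inclusion D).map f).app (op A) (indHomEquiv A X x) := by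
  simp [indHomEquiv, yonedaEquiv_comp, Functor.FullyFaithful.homEquiv]

theorem indHomEquiv_map {A B : D} (a : A ⟶ B) {X : Ind D} (x : Ind.yoneda.obj B ⟶ X) :
    indHomEquiv A X (Ind.yoneda.map a ≫ x) =
      ((Ind.inclusion D).obj X).map a.op (indHomEquiv B X x) := by
  have h : yoneda.map a ≫ Ind.yonedaCompInclusion.inv.app B =
      Ind.yonedaCompInclusion.inv.app A ≫ (Ind.inclusion D).map (Ind.yoneda.map a) :=
    Ind.yonedaCompInclusion.inv.naturality a
  change yonedaEquiv (Ind.yonedaCompInclusion.inv.app A ≫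
      (Ind.inclusion D).map (Ind.yoneda.map a ≫ x) ≫ 𝟙 _) = ((Ind.inclusion D).obj X).map a.op
      (yonedaEquiv (Ind.yonedaCompInclusion.inv.app B ≫ (Ind.inclusion D).map x ≫ 𝟙 _))
  rw [yonedaEquiv_naturality, reassoc_of% h, Functor.map_comp, Category.assoc]

/-- A morphism of ind-objects is the same as a natural family of maps on morphisms out of
representable ind-objects. -/
theorem ind_existsUnique_hom {X Y : Ind D}
    (φ : ∀ A : D, (Ind.yoneda.obj A ⟶ X) → (Ind.yoneda.obj A ⟶ Y))
    (hφ : ∀ {A B : D} (a : A ⟶ B) (x : Ind.yoneda.obj B ⟶ X),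
      φ A (Ind.yoneda.map a ≫ x) = Ind.yoneda.map a ≫ φ B x) :
    ∃! g : X ⟶ Y, ∀ (A : D) (x : Ind.yoneda.obj A ⟶ X), x ≫ g = φ A x := by
  let τ : (Ind.inclusion D).obj X ⟶ (Ind.inclusion D).obj Y :=
    { app := fun A => ↾fun x => indHomEquiv A.unop Y (φ A.unop ((indHomEquiv A.unop X).symm x))
      naturality := fun B A a => by
        ext x
        obtain ⟨x, rfl⟩ := (indHomEquiv B.unop X).surjective x
        have h1 := indHomEquiv_map a.unop x
        have h2 := indHomEquiv_map a.unop (φ _ x)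
        rw [← hφ] at h2
        rw [Equiv.eq_symm_apply _ |>.symm] at h1
        simp at h1 h2 ⊢
        rw [← h1, h2] }
  refine ⟨Ind.inclusion.fullyFaithful.preimage τ, fun A x => ?_, fun g hg => ?_⟩
  · apply (indHomEquiv A Y).injective
    rw [indHomEquiv_comp]
    simp [τ]
  · apply (Ind.inclusion D).map_injective
    rw [Functor.FullyFaithful.map_preimage]
    ext A x
    obtain ⟨x, rfl⟩ := (indHomEquiv A.unop X).surjective x
    have := indHomEquiv_comp x g
    rw [hg] at this
    simp [τ, this]

/-- Homs out of a representable ind-object, as a functor. -/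
def coyonedaIndYoneda (A : D) : coyoneda.obj (op (Ind.yoneda.obj A)) ≅
    Ind.inclusion D ⋙ (evaluation Dᵒᵖ (Type v)).obj (op A) :=
  NatIso.ofComponents (fun X => (indHomEquiv A X).toIso) (fun f => by
    ext x
    exact indHomEquiv_comp x f)

instance : PreservesColimitsOfShape ℕᵒᵖᵒᵖ (Ind.inclusion D) := by
  let e : AsSmall.{v} ℕ ≌ ℕᵒᵖᵒᵖ := AsSmall.equiv.symm.trans (opOpEquivalence ℕ).symm
  exact preservesColimitsOfShape_of_equiv e _

instance (A : D) : PreservesColimitsOfShape ℕᵒᵖᵒᵖ (coyoneda.obj (op (Ind.yoneda.obj A))) :=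
  preservesColimitsOfShape_of_natIso (coyonedaIndYoneda A).symm

end IndHom

section ProConst

variable {D : Type u} [Category.{v} D]

instance : (Pro.const D).Full :=
  inferInstanceAs (Ind.yoneda (C := Dᵒᵖ)).rightOp.Full

instance : (Pro.const D).Faithful :=
  inferInstanceAs (Ind.yoneda (C := Dᵒᵖ)).rightOp.Faithful

/-- A morphism `M ⟶ X` of pro-objects is the same as a natural way to turn morphisms from `X` to
constant pro-objects into morphisms from `M`. -/
theorem pro_existsUnique_hom {M X : Pro D}
    (φ : ∀ Y : D, (X ⟶ (Pro.const D).obj Y) → (M ⟶ (Pro.const D).obj Y))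
    (hφ : ∀ {Y Z : D} (f : Y ⟶ Z) (x : X ⟶ (Pro.const D).obj Y),
      φ Z (x ≫ (Pro.const D).map f) = φ Y x ≫ (Pro.const D).map f) :
    ∃! g : M ⟶ X, ∀ (Y : D) (x : X ⟶ (Pro.const D).obj Y), g ≫ x = φ Y x := by
  obtain ⟨g, hg, hg'⟩ := ind_existsUnique_hom (D := Dᵒᵖ) (X := Opposite.unop (α := Ind Dᵒᵖ) X)
    (Y := Opposite.unop (α := Ind Dᵒᵖ) M)
    (fun A x => (φ A.unop (Quiver.Hom.op x)).unop)
    (fun a x => congrArg Quiver.Hom.unop (hφ a.unop (Quiver.Hom.op x)))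
  refine ⟨g.op, fun Y x => ?_, fun k hk => ?_⟩
  · exact congrArg Quiver.Hom.op (hg (op Y) x.unop)
  · exact congrArg Quiver.Hom.op (hg' k.unop
      fun A x => congrArg Quiver.Hom.unop (hk A.unop (Quiver.Hom.op x)))

/-- Morphisms to constant pro-objects separate morphisms of pro-objects. -/
theorem pro_hom_ext {M X : Pro D} {g h : M ⟶ X}
    (H : ∀ (Y : D) (x : X ⟶ (Pro.const D).obj Y), g ≫ x = h ≫ x) : g = h := by
  obtain ⟨k, -, hk⟩ := pro_existsUnique_hom (M := M) (X := X) (fun Y x => h ≫ x) (by simp)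
  rw [hk g H, hk h fun _ _ => rfl]

/-- Constant pro-objects are cocompact with respect to sequential limits. -/
instance (Y : D) : PreservesColimitsOfShape ℕᵒᵖᵒᵖ (yoneda.obj ((Pro.const D).obj Y)) := by
  let U : (Pro D)ᵒᵖ ⥤ Ind Dᵒᵖ := unopUnop (Ind Dᵒᵖ)
  have : U.IsEquivalence := inferInstanceAs (unopUnop (Ind Dᵒᵖ)).IsEquivalence
  let e : U ⋙ coyoneda.obj (op (Ind.yoneda.obj (op Y))) ≅ yoneda.obj ((Pro.const D).obj Y) :=
    NatIso.ofComponents (fun X =>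
      (Quiver.Hom.opEquiv (V := Ind Dᵒᵖ) (X := Ind.yoneda.obj (op Y)) (Y := U.obj X)).toIso)
  exact preservesColimitsOfShape_of_natIso e

variable [Preadditive D]

/-- The copresheaf of abelian groups attached to a constant pro-object is corepresentable. -/
def proToAbConstIso (Y : D) :
    ((proToAb D).obj ((Pro.const D).obj Y)).unop ⋙ forget AddCommGrpCat.{v} ≅
      yoneda.obj (op Y) :=
  (indToAbForget Dᵒᵖ).app (Ind.yoneda.obj (op Y)) ≪≫ Ind.yonedaCompInclusion.app (op Y)

theorem proToAbConstIso_naturality {Y Z : D} (f : Y ⟶ Z) :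
    Functor.whiskerRight ((proToAb D).map ((Pro.const D).map f)).unop (forget _) ≫
      (proToAbConstIso Y).hom = (proToAbConstIso Z).hom ≫ yoneda.map f.op := by
  have h1 := (indToAbForget Dᵒᵖ).hom.naturality (Ind.yoneda.map f.op)
  have h2 := (Ind.yonedaCompInclusion (C := Dᵒᵖ)).hom.naturality f.op
  change _ ≫ (indToAbForget Dᵒᵖ).hom.app _ ≫ Ind.yonedaCompInclusion.hom.app _ =
    ((indToAbForget Dᵒᵖ).hom.app _ ≫ Ind.yonedaCompInclusion.hom.app _) ≫ _
  erw [reassoc_of% h1]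
  rw [Category.assoc]
  erw [← h2]
  rfl

/-- The universal element of the copresheaf attached to a constant pro-object. -/
def constElt (Y : D) : ((proToAb D).obj ((Pro.const D).obj Y)).unop.obj (op (op Y)) :=
  (proToAbConstIso Y).inv.app (op (op Y)) (𝟙 (op Y))

theorem exists_map_constElt (Y : D) {X : Dᵒᵖᵒᵖ}
    (x : ((proToAb D).obj ((Pro.const D).obj Y)).unop.obj X) :
    ∃ f : Y ⟶ X.unop.unop,
      ((proToAb D).obj ((Pro.const D).obj Y)).unop.map f.op.op (constElt Y) = x := by
  let f := (proToAbConstIso Y).hom.app X x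
  refine ⟨f.unop, ?_⟩
  have h := congrArg (fun k => k (𝟙 (op Y))) ((proToAbConstIso Y).inv.naturality f.op)
  refine h.symm.trans ?_
  change (proToAbConstIso Y).inv.app X (f ≫ 𝟙 _) = x
  rw [Category.comp_id]
  exact congrArg (fun k => k.app X x) (proToAbConstIso Y).hom_inv_id

theorem map_const_constElt {Y Z : D} (f : Y ⟶ Z) :
    ((proToAb D).map ((Pro.const D).map f)).unop.app (op (op Z)) (constElt Z) =
      ((proToAb D).obj ((Pro.const D).obj Y)).unop.map f.op.op (constElt Y) := by
  have h1 := congrArg (fun k => k.app (op (op Z)) (constElt Z)) (proToAbConstIso_naturality f)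
  have h2 := congrArg (fun k => k.app (op (op Z)) (𝟙 (op Z))) (proToAbConstIso Z).inv_hom_id
  have h3 := congrArg (fun k => k (𝟙 (op Y))) ((proToAbConstIso Y).inv.naturality f.op.op)
  have h4 := congrArg (fun k => k.app (op (op Z)) (((proToAb D).map
    ((Pro.const D).map f)).unop.app (op (op Z)) (constElt Z))) (proToAbConstIso Y).hom_inv_id
  refine h4.symm.trans (Eq.trans ?_ h3)
  change (proToAbConstIso Y).inv.app _ _ = (proToAbConstIso Y).inv.app _ _
  congr 1
  refine h1.trans ?_
  change (yoneda.map f.op).app (op (op Z))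
    ((proToAbConstIso Z).hom.app (op (op Z)) (constElt Z)) = f.op ≫ 𝟙 _
  erw [h2]
  simp

/-- A morphism to a constant pro-object is determined by the image of the universal element. -/
theorem hom_const_ext {M : Pro D} {Y : D} {y z : M ⟶ (Pro.const D).obj Y}
    (h : ((proToAb D).map y).unop.app (op (op Y)) (constElt Y) =
      ((proToAb D).map z).unop.app (op (op Y)) (constElt Y)) : y = z := by
  apply (proToAbFullyFaithful D).map_injective
  apply Quiver.Hom.unop_inj
  ext X x
  obtain ⟨f, rfl⟩ := exists_map_constElt Y x
  have h1 := ((proToAb D).map y).unop.naturality f.op.op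
  have h2 := ((proToAb D).map z).unop.naturality f.op.op
  have h1 := congrArg (fun k => k (constElt Y)) h1
  have h2 := congrArg (fun k => k (constElt Y)) h2
  refine h1.trans (Eq.trans ?_ h2.symm)
  exact congrArg _ h

instance : (Pro.const D).Additive where
  map_add {Y Z f g} := by
    apply hom_const_ext
    rw [map_const_constElt, Functor.map_add, op_add, op_add, Functor.map_add]
    change _ = ((proToAb D).map ((Pro.const D).map f)).unop.app (op (op Z)) (constElt Z) +
      ((proToAb D).map ((Pro.const D).map g)).unop.app (op (op Z)) (constElt Z)
    rw [map_const_constElt, map_const_constElt]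
    rfl

variable {R : Type w} [CommRing R] [Linear R D]

/-- The scalar action on morphisms to a constant pro-object, which is defined through the source,
may be computed on the target. -/
theorem smul_hom_const (r : R) {M : Pro D} {Y : D} (y : M ⟶ (Pro.const D).obj Y) :
    r • y = y ≫ (Pro.const D).map (r • 𝟙 Y) := by
  change proSMul R r M ≫ y = _
  apply hom_const_ext
  rw [Functor.map_comp, Functor.map_comp, proToAb_map_proSMul]
  change (copresheafSMul r ((proToAb D).obj M).unop).app (op (op Y))
      (((proToAb D).map y).unop.app (op (op Y)) (constElt Y)) =
    ((proToAb D).map y).unop.app (op (op Y))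
      (((proToAb D).map ((Pro.const D).map (r • 𝟙 Y))).unop.app (op (op Y)) (constElt Y))
  rw [map_const_constElt]
  exact (congrArg (fun k => k (constElt Y))
    (((proToAb D).map y).unop.naturality (r • 𝟙 Y).op.op)).symm

instance : (Pro.const D).Linear R where
  map_smul {X Y} f r := by
    rw [smul_hom_const, ← Functor.map_comp]
    simp

end ProConst

/-! ### Generalities on reductions -/

section ReductionLemmas

variable {R : Type w} [CommRing R] {D : Type u} [Category.{v} D] [Preadditive D] [Linear R D]

theorem smul_id_eq_zero_of_iso {X Y : D} (e : X ≅ Y) {r : R} (h : r • 𝟙 Y = 0) : r • 𝟙 X = 0 := by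
  have : e.hom ≫ (r • 𝟙 Y) ≫ e.inv = r • 𝟙 X := by simp
  rw [← this, h]
  simp

theorem smul_id_eq_zero_of_map {D' : Type*} [Category* D'] [Preadditive D'] [Linear R D']
    (F : D ⥤ D') [F.Faithful] [F.Additive] [F.Linear R] {X : D} {r : R}
    (h : r • 𝟙 (F.obj X) = 0) : r • 𝟙 X = 0 :=
  F.map_injective (by rw [F.map_smul, F.map_id, h, F.map_zero])

namespace IsReduction

variable {I : Ideal R} {M Q : D} {π : M ⟶ Q}

theorem epi (h : IsReduction I π) : Epi π where
  left_cancellation f g hfg := by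
    have hk : ∀ r ∈ I, r • (π ≫ g) = 0 := fun r hr => by
      rw [← Linear.smul_comp, h.smul_eq_zero r hr, zero_comp]
    exact (h.existsUnique_desc _ hk).unique hfg rfl

theorem smul_id_eq_zero (h : IsReduction I π) (r : R) (hr : r ∈ I) : r • 𝟙 Q = 0 := by
  have := h.epi
  rw [← cancel_epi π, Linear.comp_smul, Category.comp_id, h.smul_eq_zero r hr, comp_zero]

theorem of_epi [Epi π] (h0 : ∀ r ∈ I, r • π = 0)
    (h : ∀ ⦃X : D⦄ (f : M ⟶ X), (∀ r ∈ I, r • f = 0) → ∃ g : Q ⟶ X, π ≫ g = f) :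
    IsReduction I π where
  smul_eq_zero := h0
  existsUnique_desc X f hf := by
    obtain ⟨g, hg⟩ := h f hf
    exact ⟨g, hg, fun g' hg' => by rw [← cancel_epi π, hg, hg']⟩

theorem of_isIso [IsIso π] (h0 : ∀ r ∈ I, r • 𝟙 Q = 0) : IsReduction I π :=
  of_epi (fun r hr => by
    rw [← Category.comp_id π, ← Linear.comp_smul, h0 r hr, comp_zero])
    fun X f _ => ⟨inv π ≫ f, by simp⟩

theorem comp_isIso (h : IsReduction I π) {Q' : D} (e : Q ⟶ Q') [IsIso e] :
    IsReduction I (π ≫ e) := by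
  have := h.epi
  exact of_epi (fun r hr => by rw [← Linear.smul_comp, h.smul_eq_zero r hr, zero_comp])
    fun X f hf => ⟨inv e ≫ (h.existsUnique_desc f hf).choose, by
      simpa using (h.existsUnique_desc f hf).choose_spec.1⟩

theorem isIso_comp (h : IsReduction I π) {M' : D} (e : M' ⟶ M) [IsIso e] :
    IsReduction I (e ≫ π) := by
  have := h.epi
  refine of_epi (fun r hr => by rw [← Linear.comp_smul, h.smul_eq_zero r hr, comp_zero])
    fun X f hf => ?_
  obtain ⟨g, hg, -⟩ := h.existsUnique_desc (inv e ≫ f) (fun r hr => by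
    rw [← Linear.comp_smul, hf r hr, comp_zero])
  exact ⟨g, by simp [hg]⟩

theorem of_comp (h : IsReduction I π) {I' : Ideal R} {Q' : D} {f : Q ⟶ Q'}
    (h' : IsReduction I' (π ≫ f)) : IsReduction I' f := by
  have := h.epi
  have := h'.epi
  have := epi_of_epi π f
  refine of_epi (fun r hr => by
    rw [← cancel_epi π, Linear.comp_smul, h'.smul_eq_zero r hr, comp_zero]) fun X g hg => ?_
  obtain ⟨k, hk, -⟩ := h'.existsUnique_desc (π ≫ g) fun r hr => by
    rw [← Linear.comp_smul, hg r hr, comp_zero]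
  exact ⟨k, by rwa [← cancel_epi π, ← Category.assoc]⟩

theorem exists_iso (h : IsReduction I π) {Q' : D} {π' : M ⟶ Q'} (h' : IsReduction I π') :
    ∃ e : Q ≅ Q', π ≫ e.hom = π' := by
  have := h.epi
  have := h'.epi
  obtain ⟨f, hf, -⟩ := h.existsUnique_desc π' h'.smul_eq_zero
  obtain ⟨g, hg, -⟩ := h'.existsUnique_desc π h.smul_eq_zero
  refine ⟨⟨f, g, ?_, ?_⟩, hf⟩
  · rw [← cancel_epi π, reassoc_of% hf, hg, Category.comp_id]
  · rw [← cancel_epi π', reassoc_of% hg, hf, Category.comp_id]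

theorem of_map {D' : Type*} [Category* D'] [Preadditive D'] [Linear R D'] (F : D ⥤ D') [F.Full]
    [F.Faithful] [F.Additive] [F.Linear R] (h : IsReduction I (F.map π)) : IsReduction I π := by
  have := h.epi
  have := F.epi_of_epi_map this
  refine of_epi (fun r hr => F.map_injective (by
    rw [F.map_smul, F.map_zero, h.smul_eq_zero r hr])) fun X f hf => ?_
  obtain ⟨g, hg, -⟩ := h.existsUnique_desc (F.map f) fun r hr => by
    rw [← F.map_smul, hf r hr, F.map_zero]
  exact ⟨F.preimage g, F.map_injective (by simpa using hg)⟩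

theorem isIso_of_smul_id_eq_zero (h : IsReduction I π) (h0 : ∀ r ∈ I, r • 𝟙 M = 0) : IsIso π := by
  obtain ⟨e, he⟩ := (of_isIso (π := 𝟙 M) h0).exists_iso h
  rw [← he]
  infer_instance

end IsReduction

/-- Two towers of reductions of the same object are isomorphic. -/
theorem exists_towerIso {J : Ideal R} {M : D} {T T' : ℕᵒᵖ ⥤ D}
    (π : (Functor.const ℕᵒᵖ).obj M ⟶ T) (π' : (Functor.const ℕᵒᵖ).obj M ⟶ T')
    (h : ∀ n : ℕ, IsReduction (J ^ n) (π.app (op n)))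
    (h' : ∀ n : ℕ, IsReduction (J ^ n) (π'.app (op n))) :
    ∃ e : T ≅ T', π ≫ e.hom = π' := by
  choose e he using fun n => (h n).exists_iso (h' n)
  have nat {n m : ℕᵒᵖ} (f : n ⟶ m) : π.app n ≫ T.map f = π.app m := by
    simpa using (π.naturality f).symm
  have nat' {n m : ℕᵒᵖ} (f : n ⟶ m) : π'.app n ≫ T'.map f = π'.app m := by
    simpa using (π'.naturality f).symm
  refine ⟨NatIso.ofComponents (fun n => e n.unop) fun {n m} f => ?_, ?_⟩
  · have : Epi (π.app n) := (h n.unop).epi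
    rw [← cancel_epi (π.app n), reassoc_of% (nat f), reassoc_of% (he n.unop)]
    exact (he m.unop).trans (nat' f).symm
  · ext n
    exact he n.unop

/-- A cone over a tower whose components are eventually isomorphisms is a limit cone. -/
def isLimitOfEventuallyIso {D : Type*} [Category* D] {T : ℕᵒᵖ ⥤ D} (c : Cone T) (n : ℕ)
    (h : ∀ m, n ≤ m → IsIso (c.π.app (op m))) : IsLimit c :=
  have := h n le_rfl
  { lift s := s.π.app (op n) ≫ inv (c.π.app (op n))
    fac s m := by
      have hl := h (max n m.unop) (le_max_left _ _)
      let a : op (max n m.unop) ⟶ op n := (homOfLE (le_max_left n m.unop)).op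
      let b : op (max n m.unop) ⟶ m := (homOfLE (le_max_right n m.unop)).op
      have h1 : T.map a = inv (c.π.app (op (max n m.unop))) ≫ c.π.app (op n) := by
        rw [IsIso.eq_inv_comp, c.w]
      have h2 : T.map b = inv (c.π.app (op (max n m.unop))) ≫ c.π.app m := by
        rw [IsIso.eq_inv_comp, c.w]
      rw [← s.w a, ← s.w b, h1, h2]
      simp
    uniq s m hm := by
      rw [IsIso.eq_comp_inv, hm] }

end ReductionLemmas

/-! ### Adic towers -/

section Towers

variable {R : Type w} [CommRing R] (J : Ideal R) (D : Type u) [Category.{v} D] [Preadditive D]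
  [Linear R D]

/-- A tower `⋯ ⟶ T₂ ⟶ T₁ ⟶ T₀` is adic if its transition morphisms identify `Tₙ` with
`Tₘ / TₘJⁿ` for `n ≤ m`; for `m = n` this says that `Tₙ` is killed by `Jⁿ`. -/
def isAdicTower : ObjectProperty (ℕᵒᵖ ⥤ D) := fun T =>
  ∀ ⦃n m : ℕᵒᵖ⦄ (f : m ⟶ n), IsReduction (J ^ n.unop) (T.map f)

/-- The category of adic towers. -/
abbrev AdicTower : Type max v u := (isAdicTower J D).FullSubcategory

variable {J D}

theorem isAdicTower.of_reductions {M : D} {T : ℕᵒᵖ ⥤ D} (π : (Functor.const ℕᵒᵖ).obj M ⟶ T)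
    (h : ∀ n : ℕ, IsReduction (J ^ n) (π.app (op n))) : isAdicTower J D T := fun n m f => by
  refine (h m.unop).of_comp ?_
  have := (π.naturality f).symm
  simp only [Functor.const_obj_obj, Functor.const_obj_map, Category.id_comp] at this
  exact this ▸ h n.unop

theorem isAdicTower.smul_id_eq_zero {T : ℕᵒᵖ ⥤ D} (hT : isAdicTower J D T) (n : ℕᵒᵖ) (r : R)
    (hr : r ∈ J ^ n.unop) : r • 𝟙 (T.obj n) = 0 :=
  (hT (𝟙 n)).smul_id_eq_zero r hr

theorem isAdicTower.of_iso {T T' : ℕᵒᵖ ⥤ D} (hT : isAdicTower J D T) (e : T ≅ T') :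
    isAdicTower J D T' := fun n m f => by
  have := ((hT f).isIso_comp (e.inv.app m)).comp_isIso (e.hom.app n)
  rwa [Category.assoc, e.hom.naturality f, e.inv_hom_id_app_assoc] at this

section

variable {T : ℕᵒᵖ ⥤ D} {c : Cone (T ⋙ Pro.const D)} (hc : IsLimit c)

include hc

omit [Preadditive D] in
/-- Morphisms from the limit of a tower to a constant pro-object come from a term of the tower. -/
theorem exists_factor_const {Y : D} (y : c.pt ⟶ (Pro.const D).obj Y) :
    ∃ (n : ℕᵒᵖ) (g : T.obj n ⟶ Y), c.π.app n ≫ (Pro.const D).map g = y := by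
  obtain ⟨n, g, hg⟩ := Types.jointly_surjective _
    (isColimitOfPreserves (yoneda.obj ((Pro.const D).obj Y)) hc.op) y
  obtain ⟨g, rfl⟩ := (Pro.const D).map_surjective g
  exact ⟨n.unop, g, hg⟩

/-- A morphism from a term of a tower to a constant pro-object that vanishes on the limit vanishes
on some term. -/
theorem exists_map_comp_eq_zero {Y : D} {n : ℕᵒᵖ} (g : T.obj n ⟶ Y)
    (hg : c.π.app n ≫ (Pro.const D).map g = 0) : ∃ (m : ℕᵒᵖ) (f : m ⟶ n), T.map f ≫ g = 0 := by
  have h := isColimitOfPreserves (yoneda.obj ((Pro.const D).obj Y)) hc.op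
  obtain ⟨m, f, hf⟩ := (Types.FilteredColimit.isColimit_eq_iff' h (i := op n)
    ((Pro.const D).map g) ((Pro.const D).map (0 : T.obj n ⟶ Y))).1 (by
      change c.π.app n ≫ _ = c.π.app n ≫ _
      rw [hg, Functor.map_zero, comp_zero])
  refine ⟨m.unop, f.unop, (Pro.const D).map_injective ?_⟩
  have hf' : (Pro.const D).map (T.map f.unop) ≫ (Pro.const D).map g =
    (Pro.const D).map (T.map f.unop) ≫ (Pro.const D).map (0 : T.obj n ⟶ Y) := hf
  rw [Functor.map_comp, hf', Functor.map_zero, comp_zero, Functor.map_zero]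

variable (hT : isAdicTower J D T)

include hT

theorem isAdicTower.eq_zero {Y : D} {n : ℕᵒᵖ} (g : T.obj n ⟶ Y)
    (hg : c.π.app n ≫ (Pro.const D).map g = 0) : g = 0 := by
  obtain ⟨m, f, hf⟩ := exists_map_comp_eq_zero hc g hg
  have := (hT f).epi
  rwa [← cancel_epi (T.map f), comp_zero]

theorem isAdicTower.epi_π (n : ℕᵒᵖ) : Epi (c.π.app n) where
  left_cancellation {X} g h hgh := by
    refine pro_hom_ext fun Y x => ?_
    obtain ⟨k, hk⟩ := (Pro.const D).map_surjective (g ≫ x - h ≫ x)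
    have := hT.eq_zero hc (n := n) k (by
      rw [hk, Preadditive.comp_sub, reassoc_of% hgh, sub_self])
    rw [← sub_eq_zero, ← hk, this, Functor.map_zero]

/-- The quotient by `Jⁿ` of the limit in pro-objects of an adic tower is its `n`-th term. -/
theorem isAdicTower.isReduction_π (n : ℕ) : IsReduction (J ^ n) (c.π.app (op n)) := by
  have hepi := hT.epi_π hc (op n)
  have key {Y : D} (y : c.pt ⟶ (Pro.const D).obj Y) (hy : ∀ r ∈ J ^ n, r • y = 0) :
      ∃ g : T.obj (op n) ⟶ Y, c.π.app (op n) ≫ (Pro.const D).map g = y := by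
    obtain ⟨m, g, rfl⟩ := exists_factor_const hc y
    wlog hmn : n ≤ m.unop generalizing m
    · let f : op n ⟶ m := (homOfLE (le_of_not_ge hmn)).op
      refine ⟨T.map f ≫ g, ?_⟩
      rw [Functor.map_comp, ← c.w f, Category.assoc]
      rfl
    let f : m ⟶ op n := (homOfLE hmn).op
    obtain ⟨h, rfl, -⟩ := (hT f).existsUnique_desc g fun r hr => hT.eq_zero hc _ (by
      rw [Functor.map_smul, Linear.comp_smul, hy r hr])
    refine ⟨h, ?_⟩
    rw [Functor.map_comp, ← c.w f, Category.assoc]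
    rfl
  refine IsReduction.of_epi (fun r hr => ?_) fun X f hf => ?_
  · erw [smul_hom_const, hT.smul_id_eq_zero (op n) r hr, Functor.map_zero, comp_zero]
  · choose φ hφ using fun (Y : D) (x : X ⟶ (Pro.const D).obj Y) => key (f ≫ x) fun r hr => by
      rw [← Linear.smul_comp, hf r hr, zero_comp]
    obtain ⟨g, hg, -⟩ := pro_existsUnique_hom
      (fun Y x => (Pro.const D).map (φ Y x)) (fun {Y Z} a x => by
        have h := hφ Y x
        rw [← cancel_epi (c.π.app (op n)), hφ, ← Category.assoc, ← h, Category.assoc])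
    exact ⟨g, pro_hom_ext fun Y x => by rw [Category.assoc, hg, hφ]⟩

omit hc hT in
/-- Morphisms between limits of adic towers are induced by morphisms of towers. -/
theorem isAdicTower.exists_hom {T T' : ℕᵒᵖ ⥤ D} (hT : isAdicTower J D T)
    {c : Cone (T ⋙ Pro.const D)} (hc : IsLimit c) (hT' : isAdicTower J D T')
    {c' : Cone (T' ⋙ Pro.const D)} (hc' : IsLimit c') (h : c.pt ⟶ c'.pt) :
    ∃ f : T ⟶ T', ∀ n, c.π.app n ≫ (Pro.const D).map (f.app n) = h ≫ c'.π.app n := by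
  have (n : ℕᵒᵖ) : ∃ f : T.obj n ⟶ T'.obj n,
      c.π.app n ≫ (Pro.const D).map f = h ≫ c'.π.app n := by
    obtain ⟨g, hg, -⟩ := (hT.isReduction_π hc n.unop).existsUnique_desc (h ≫ c'.π.app n)
      fun r hr => by
        rw [← Linear.comp_smul]
        exact (congrArg _ ((hT'.isReduction_π hc' n.unop).smul_eq_zero r hr)).trans comp_zero
    obtain ⟨f, rfl⟩ := (Pro.const D).map_surjective g
    exact ⟨f, hg⟩
  choose f hf using this
  refine ⟨⟨f, fun n m a => ?_⟩, hf⟩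
  have := hT.epi_π hc n
  refine (Pro.const D).map_injective ?_
  have h1 : c.π.app n ≫ (Pro.const D).map (T.map a) = c.π.app m := c.w a
  have h2 : c'.π.app n ≫ (Pro.const D).map (T'.map a) = c'.π.app m := c'.w a
  rw [← cancel_epi (c.π.app n), Functor.map_comp, Functor.map_comp, reassoc_of% (hf n), h2,
    reassoc_of% h1, hf]

theorem isAdicTower.isAdic_pt : isAdic J D c.pt :=
  ⟨T ⋙ Pro.const D, c.π, hT.isReduction_π hc, fun _ => ⟨_, ⟨Iso.refl _⟩⟩, ⟨hc⟩⟩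

end

variable (J D)

/-- The limit of an adic tower, as an object of the completion. -/
def limTower : AdicTower J D ⥤ Completion J D :=
  ObjectProperty.lift (isAdic J D) ((isAdicTower J D).ι ⋙
    (Functor.whiskeringRight ℕᵒᵖ D (Pro D)).obj (Pro.const D) ⋙ lim)
    fun T => T.property.isAdic_pt (limit.isLimit (T.obj ⋙ Pro.const D))

variable {J D} in
theorem limTower_map_π {T T' : AdicTower J D} (f : T ⟶ T') (n : ℕᵒᵖ) :
    ((limTower J D).map f).hom ≫ limit.π (T'.obj ⋙ Pro.const D) n =
      limit.π (T.obj ⋙ Pro.const D) n ≫ (Pro.const D).map (f.hom.app n) :=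
  limMap_π _ _

instance : (limTower J D).Faithful where
  map_injective {T T'} f g h := by
    ext n
    have := T.property.epi_π (limit.isLimit (T.obj ⋙ Pro.const D)) n
    refine (Pro.const D).map_injective ?_
    rw [← cancel_epi ((limit.cone (T.obj ⋙ Pro.const D)).π.app n)]
    exact (limTower_map_π f n).symm.trans ((congrArg (fun k => InducedCategory.Hom.hom k ≫ _)
      h).trans (limTower_map_π g n))

instance : (limTower J D).Full where
  map_surjective {T T'} h := by
    obtain ⟨f, hf⟩ := T.property.exists_hom (limit.isLimit (T.obj ⋙ Pro.const D)) T'.property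
      (limit.isLimit (T'.obj ⋙ Pro.const D)) h.hom
    refine ⟨ObjectProperty.homMk f, ?_⟩
    ext
    refine limit.hom_ext fun n => ?_
    exact (limTower_map_π _ _).trans (hf n)

instance : (limTower J D).EssSurj where
  mem_essImage M := by
    obtain ⟨T, π, h, h', ⟨hc⟩⟩ := M.property
    let T₀ := Functor.essImage.liftFunctor T (Pro.const D) fun n => h' n.unop
    let e : T₀ ⋙ Pro.const D ≅ T := Functor.essImage.liftFunctorCompIso _ _ _
    have hT₀ : isAdicTower J D T₀ := fun n m f =>
      IsReduction.of_map (Pro.const D) ((isAdicTower.of_reductions π h).of_iso e.symm f)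
    exact ⟨⟨T₀, hT₀⟩, ⟨ObjectProperty.isoMk _ (IsLimit.conePointsIsoOfNatIso
      (limit.isLimit (T₀ ⋙ Pro.const D)) hc e)⟩⟩

/-- The completion is equivalent to the category of adic towers. -/
instance : (limTower J D).IsEquivalence where

end Towers

/-! ### The canonical functor of the completion -/

section Canonical

variable {R : Type w} [CommRing R] (J : Ideal R) (D : Type u) [Category.{v} D] [Preadditive D]
  [Linear R D]

section

variable [HasReductions J D]

variable {D} in
/-- The projections from `M` to the tower of the `M / MJⁿ`. -/
def redTowerπ (M : D) : (Functor.const ℕᵒᵖ).obj M ⟶ (redTower J D).obj M where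
  app n := redπ J n.unop M
  naturality n m f := by
    dsimp [redTower]
    rw [redπ_map]

variable {D} in
theorem isAdicTower_redTower (M : D) : isAdicTower J D ((redTower J D).obj M) :=
  isAdicTower.of_reductions (redTowerπ J M) fun n => isReduction_redπ J n M

/-- The functor sending `M` to the adic tower of the `M / MJⁿ`. -/
def toAdicTower : D ⥤ AdicTower J D :=
  ObjectProperty.lift (isAdicTower J D) (redTower J D) (isAdicTower_redTower J)

variable {D} in
theorem isAdic_toPro (M : D) : isAdic J D ((toPro J D).obj M) :=
  (isAdicTower_redTower J M).isAdic_pt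
    (limit.isLimit ((redTower J D).obj M ⋙ Pro.const D))

/-- The canonical functor is the composition of `toAdicTower` and the equivalence `limTower`. -/
theorem isEquivalence_lift_toPro [(toAdicTower J D).IsEquivalence] :
    (ObjectProperty.lift (isAdic J D) (toPro J D) (isAdic_toPro J)).IsEquivalence :=
  inferInstanceAs (toAdicTower J D ⋙ limTower J D).IsEquivalence

variable {J D} in
/-- An object of `D` killed by a power of the ideal is adic as a constant pro-object. -/
theorem isAdic_const {X : D} (n : ℕ) (hX : ∀ r ∈ J ^ n, r • 𝟙 X = 0) :
    isAdic J D ((Pro.const D).obj X) := by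
  refine (isAdicTower_redTower J X).isAdic_pt
    (c := (Pro.const D).mapCone (Cone.mk X (redTowerπ J X)))
    (isLimitOfEventuallyIso _ n fun m hm => ?_)
  have : IsIso (redπ J m X) := (isReduction_redπ J m X).isIso_of_smul_id_eq_zero fun r hr =>
    hX r (Ideal.pow_le_pow_right hm hr)
  exact inferInstanceAs (IsIso ((Pro.const D).map (redπ J m X)))

end

section

variable {J D}

variable [HasReductions J D]

/-- The tower of reductions of an object of the completion, formed in pro-objects, lies in the
completion. -/
theorem exists_completion_tower (M : Completion J D) :
    ∃ (T : ℕᵒᵖ ⥤ Completion J D) (π : (Functor.const ℕᵒᵖ).obj M ⟶ T),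
      (∀ n : ℕ, IsReduction (J ^ n) (π.app (op n)).hom) ∧
      Nonempty (IsLimit ((isAdic J D).ι.mapCone (Cone.mk M π))) := by
  obtain ⟨T, π, h, h', ⟨hc⟩⟩ := M.property
  have hT := isAdicTower.of_reductions π h
  have had (n : ℕᵒᵖ) : isAdic J D (T.obj n) := by
    obtain ⟨X, ⟨e⟩⟩ := h' n.unop
    obtain ⟨T', π', a, b, ⟨c⟩⟩ := isAdic_const (J := J) (X := X) n.unop fun r hr =>
      smul_id_eq_zero_of_map (Pro.const D)
        (smul_id_eq_zero_of_iso e (hT.smul_id_eq_zero n r hr))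
    refine ⟨T', (Functor.const ℕᵒᵖ).map e.inv ≫ π', fun n => ?_, b, ⟨?_⟩⟩
    · exact (a n).isIso_comp e.inv
    · exact IsLimit.ofIsoLimit c (Cone.ext e (fun j => by simp))
  refine ⟨ObjectProperty.lift _ T had, ⟨fun n => ObjectProperty.homMk (π.app n), fun n m f => ?_⟩,
    h, ⟨hc⟩⟩
  ext
  exact π.naturality f

instance : HasReductions J (Completion J D) where
  exists_reduction n M := by
    obtain ⟨T, π, h, -⟩ := exists_completion_tower M
    exact ⟨_, π.app (op n), (h n).of_map (isAdic J D).ι⟩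

/-- An object of the completion is the limit of its reductions within the completion. -/
theorem nonempty_isLimit_redTower (M : Completion J D) :
    Nonempty (IsLimit (Cone.mk M (redTowerπ J M))) := by
  obtain ⟨T, π, h, ⟨hc⟩⟩ := exists_completion_tower M
  obtain ⟨e, he⟩ := exists_towerIso π (redTowerπ J M) (fun n => (h n).of_map (isAdic J D).ι)
    fun n => isReduction_redπ J n M
  have hc' := isLimitOfReflects (isAdic J D).ι hc
  exact ⟨((IsLimit.postcomposeHomEquiv e _).symm hc').ofIsoLimit
    (Cone.ext (Iso.refl _) fun n => by simp [← he])⟩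

instance : (toAdicTower J (Completion J D)).Faithful where
  map_injective {M N} f g h := by
    obtain ⟨hN⟩ := nonempty_isLimit_redTower N
    refine hN.hom_ext fun n => ?_
    have := congrArg (fun k => redπ J n.unop M ≫ k.hom.app n) h
    have h1 := redπ_map (J := J) (le_refl n.unop) f
    have h2 := redπ_map (J := J) (le_refl n.unop) g
    exact h1.symm.trans (this.trans h2)

instance : (toAdicTower J (Completion J D)).Full where
  map_surjective {M N} φ := by
    obtain ⟨hN⟩ := nonempty_isLimit_redTower N
    let f : M ⟶ N := hN.lift (Cone.mk M (redTowerπ J M ≫ φ.hom))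
    refine ⟨f, ?_⟩
    ext n
    refine InducedCategory.hom_ext_iff.1 (red_hom_ext ?_)
    exact (redπ_map (J := J) (le_refl n.unop) f).trans (hN.fac _ n)

omit [HasReductions J D] in
/-- A term of an adic tower in the completion is a constant pro-object. -/
theorem essImage_of_isAdicTower {T : ℕᵒᵖ ⥤ Completion J D} (hT : isAdicTower J _ T) (n : ℕᵒᵖ) :
    (Pro.const D).essImage (T.obj n).obj := by
  obtain ⟨T', π', h, h', -⟩ := (T.obj n).property
  have : IsIso (π'.app n) := (h n.unop).isIso_of_smul_id_eq_zero fun r hr =>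
    (isAdic J D).ι.congr_map (hT.smul_id_eq_zero n r hr)
  exact Functor.essImage.ofIso (asIso (π'.app n)).symm (h' n.unop)

instance : (toAdicTower J (Completion J D)).EssSurj where
  mem_essImage T := by
    let T₀ := Functor.essImage.liftFunctor (T.obj ⋙ (isAdic J D).ι) (Pro.const D)
      (essImage_of_isAdicTower T.property)
    let e : T₀ ⋙ Pro.const D ≅ T.obj ⋙ (isAdic J D).ι :=
      Functor.essImage.liftFunctorCompIso _ _ _
    have h0 (n : ℕᵒᵖ) (r : R) (hr : r ∈ J ^ n.unop) : r • 𝟙 (T₀.obj n) = 0 :=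
      smul_id_eq_zero_of_map (Pro.const D) (smul_id_eq_zero_of_iso (e.app n)
        ((isAdic J D).ι.congr_map (T.property.smul_id_eq_zero n r hr)))
    let T₁ : ℕᵒᵖ ⥤ Completion J D := ObjectProperty.lift _ (T₀ ⋙ Pro.const D)
      fun n => isAdic_const n.unop (h0 n)
    let e₁ : T₁ ≅ T.obj :=
      ((Functor.FullyFaithful.ofFullyFaithful (isAdic J D).ι).whiskeringRight ℕᵒᵖ).preimageIso e
    have hT₁ : isAdicTower J _ T₁ := T.property.of_iso e₁.symm
    have hT₀ : isAdicTower J D T₀ := fun n m f => by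
      -- compare `T₀ n` with the reduction of `T₀ m` formed in `D`, which is also in the completion
      have hq := isReduction_redπ J n.unop (T₀.obj m)
      obtain ⟨k, hk, -⟩ := hq.existsUnique_desc (T₀.map f) fun r hr => by
        rw [← Category.comp_id (T₀.map f), ← Linear.comp_smul, h0 n r hr, comp_zero]
      let Q : Completion J D := ⟨(Pro.const D).obj (red J n.unop (T₀.obj m)),
        isAdic_const n.unop hq.smul_id_eq_zero⟩
      let q : T₁.obj m ⟶ Q := ObjectProperty.homMk ((Pro.const D).map (redπ J n.unop (T₀.obj m)))
      obtain ⟨g, hg, -⟩ := (hT₁ f).existsUnique_desc q fun r hr => by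
        ext
        exact ((Pro.const D).map_smul r _).symm.trans (by
          rw [hq.smul_eq_zero r hr, Functor.map_zero]; rfl)
      obtain ⟨g₀, hg₀⟩ := (Pro.const D).map_surjective g.hom
      have hg' : T₀.map f ≫ g₀ = redπ J n.unop (T₀.obj m) := (Pro.const D).map_injective (by
        rw [Functor.map_comp, hg₀]
        exact (isAdic J D).ι.congr_map hg)
      have h1 : k ≫ g₀ = 𝟙 _ := red_hom_ext (by rw [reassoc_of% hk, hg', Category.comp_id])
      have h2 : g₀ ≫ k = 𝟙 _ := by
        have := (hT₁ f).epi
        let l : T₁.obj n ⟶ T₁.obj n := ObjectProperty.homMk ((Pro.const D).map (g₀ ≫ k))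
        have : l = 𝟙 _ := by
          rw [← cancel_epi (T₁.map f), Category.comp_id]
          ext
          refine ((Pro.const D).map_comp _ _).symm.trans ?_
          rw [reassoc_of% hg', hk]
          rfl
        exact (Pro.const D).map_injective
          (((isAdic J D).ι.congr_map this).trans ((Pro.const D).map_id _).symm)
      have : IsIso k := ⟨g₀, h1, h2⟩
      rw [← hk]
      exact hq.comp_isIso k
    let M : Completion J D := (limTower J D).obj ⟨T₀, hT₀⟩
    let π : (Functor.const ℕᵒᵖ).obj M ⟶ T₁ :=
      { app n := ObjectProperty.homMk (limit.π (T₀ ⋙ Pro.const D) n)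
        naturality n m f := by
          ext
          exact (limit.cone (T₀ ⋙ Pro.const D)).π.naturality f }
    obtain ⟨e₂, -⟩ := exists_towerIso (redTowerπ J M) π (fun n => isReduction_redπ J n M)
      fun n => (hT₀.isReduction_π (limit.isLimit (T₀ ⋙ Pro.const D)) n).of_map (isAdic J D).ι
    exact ⟨M, ⟨ObjectProperty.isoMk _ (e₂ ≪≫ e₁)⟩⟩

instance : (toAdicTower J (Completion J D)).IsEquivalence where

end

end Canonical

/-! ### Exact embeddings into modules -/

section Embedding

/-- A faithful exact `R`-linear functor to modules. -/
class IsExactEmbedding {R : Type w} [CommRing R] {C : Type u} [Category.{v} C] [Abelian C]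
    [Linear R C] (E : C ⥤ ModuleCat.{max u v} R) : Prop extends E.Additive, E.Faithful,
    E.Linear R where
  range_eq_ker : ∀ {S : ShortComplex C}, S.Exact →
    LinearMap.range (E.map S.f).hom = LinearMap.ker (E.map S.g).hom

variable {R : Type w} [CommRing R] {C : Type u} [Category.{v} C] [Abelian C] [Linear R C]

variable (R C) in
/-- The Freyd–Mitchell embedding into modules over some ring `S` gives an embedding into
`R`-modules: forget the action of `S`, and let `R` act by functoriality. -/
theorem exists_isExactEmbedding : ∃ E : C ⥤ ModuleCat.{max u v} R, IsExactEmbedding E := by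
  obtain ⟨S, _, F, -, _, _, _⟩ := Abelian.freyd_mitchell C
  have := Functor.additive_of_preserves_binary_products F
  let ρ (X : C) : R →+* AddMonoid.End (F.obj X) :=
    { toFun r := (F.map (r • 𝟙 X)).hom.toAddMonoidHom
      map_one' := by
        ext
        simp
        rfl
      map_mul' r s := by
        ext x
        have : (r * s) • 𝟙 X = (s • 𝟙 X) ≫ (r • 𝟙 X) := by simp [mul_smul]
        rw [this, F.map_comp]
        rfl
      map_zero' := by
        ext
        simp
        rfl
      map_add' r s := by
        ext
        rw [add_smul, F.map_add]
        rfl }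
  let m (X : C) : Module R (F.obj X) := Module.compHom _ (ρ X)
  let E : C ⥤ ModuleCat.{max u v} R :=
    { obj X := letI := m X; ModuleCat.of R (F.obj X)
      map {X Y} f := letI := m X; letI := m Y; ModuleCat.ofHom
        { toFun := (F.map f).hom
          map_add' := map_add _
          map_smul' := fun r x => by
            change F.map f (F.map (r • 𝟙 X) x) = F.map (r • 𝟙 Y) (F.map f x)
            rw [← ConcreteCategory.comp_apply, ← ConcreteCategory.comp_apply, ← F.map_comp,
              ← F.map_comp]
            simp }
      map_id X := by
        ext x
        change F.map (𝟙 X) x = x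
        simp
      map_comp f g := by
        ext x
        change F.map (f ≫ g) x = F.map g (F.map f x)
        simp }
  have hE {X Y : C} (f : X ⟶ Y) (x : F.obj X) : E.map f x = F.map f x := rfl
  have : E.Additive := ⟨fun {X Y f g} => by
    ext x
    refine (hE (f + g) x).trans ?_
    rw [F.map_add]
    rfl⟩
  have : E.Faithful := ⟨fun {X Y f g} h => F.map_injective (by
    ext x
    exact congrArg (fun k => k x) h)⟩
  have : E.Linear R := ⟨fun {X Y} f r => by
    ext x
    change F.map (r • f) x = F.map (r • 𝟙 Y) (F.map f x)
    rw [← ConcreteCategory.comp_apply, ← F.map_comp]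
    simp⟩
  refine ⟨E, { range_eq_ker := fun {S} hS => ?_ }⟩
  have h := (ShortComplex.moduleCat_exact_iff_range_eq_ker _).1 (hS.map F)
  ext x
  exact SetLike.ext_iff.1 h x

variable (E : C ⥤ ModuleCat.{max u v} R) [IsExactEmbedding E]

theorem range_kernel_ι {X Y : C} (f : X ⟶ Y) :
    LinearMap.range (E.map (kernel.ι f)).hom = LinearMap.ker (E.map f).hom :=
  IsExactEmbedding.range_eq_ker (ShortComplex.exact_kernel f)

theorem ker_cokernel_π {X Y : C} (f : X ⟶ Y) :
    LinearMap.ker (E.map (cokernel.π f)).hom = LinearMap.range (E.map f).hom :=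
  (IsExactEmbedding.range_eq_ker (ShortComplex.exact_cokernel f)).symm

theorem map_eq_zero_iff {X Y : C} (f : X ⟶ Y) : (∀ x, E.map f x = 0) ↔ f = 0 := by
  constructor
  · intro h
    refine E.map_injective ?_
    ext x
    rw [h, E.map_zero]
    rfl
  · rintro rfl x
    rw [E.map_zero]
    rfl

theorem epi_iff_surjective {X Y : C} (f : X ⟶ Y) : Epi f ↔ Function.Surjective (E.map f) := by
  refine ⟨fun h => ?_, fun h => ?_⟩
  · have h1 := ker_cokernel_π E f
    rw [cokernel.π_of_epi] at h1
    refine LinearMap.range_eq_top.1 (h1.symm.trans ?_)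
    rw [E.map_zero]
    exact LinearMap.ker_zero
  · exact E.epi_of_epi_map ((ModuleCat.epi_iff_surjective _).2 h)

theorem mono_iff_injective {X Y : C} (f : X ⟶ Y) : Mono f ↔ Function.Injective (E.map f) := by
  refine ⟨fun h => ?_, fun h => ?_⟩
  · have h1 := range_kernel_ι E f
    rw [kernel.ι_of_mono, E.map_zero] at h1
    exact LinearMap.ker_eq_bot.1 (h1.symm.trans LinearMap.range_zero)
  · exact E.mono_of_mono_map ((ModuleCat.mono_iff_injective _).2 h)

theorem exists_desc {X Y Z : C} (p : X ⟶ Y) [Epi p] (f : X ⟶ Z)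
    (h : LinearMap.ker (E.map p).hom ≤ LinearMap.ker (E.map f).hom) : ∃ g, p ≫ g = f := by
  have : kernel.ι p ≫ f = 0 := by
    refine (map_eq_zero_iff E _).1 fun x => ?_
    rw [E.map_comp]
    refine h ?_
    rw [← range_kernel_ι]
    exact ⟨x, rfl⟩
  exact ⟨_, (CokernelCofork.IsColimit.desc' (Abelian.epiIsCokernelOfKernel _
    (limit.isLimit (parallelPair p 0))) f this).2⟩

theorem exists_lift {X Y Z : C} (i : X ⟶ Y) [Mono i] (f : Z ⟶ Y)
    (h : LinearMap.range (E.map f).hom ≤ LinearMap.range (E.map i).hom) : ∃ g, g ≫ i = f := by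
  have : f ≫ cokernel.π i = 0 := by
    refine (map_eq_zero_iff E _).1 fun x => ?_
    rw [E.map_comp]
    have : E.map f x ∈ LinearMap.ker (E.map (cokernel.π i)).hom := by
      rw [ker_cokernel_π]
      exact h ⟨x, rfl⟩
    exact this
  exact ⟨_, (KernelFork.IsLimit.lift' (Abelian.monoIsKernelOfCokernel _
    (colimit.isColimit (parallelPair i 0))) f this).2⟩

variable {E}

theorem map_smul_apply (r : R) {X Y : C} (f : X ⟶ Y) (x : E.obj X) :
    E.map (r • f) x = r • E.map f x := by
  rw [E.map_smul]
  rfl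

theorem smul_id_apply (r : R) {X : C} (x : E.obj X) : E.map (r • 𝟙 X) x = r • x := by
  rw [map_smul_apply, E.map_id]
  rfl

variable (E) in
/-- A submodule of `E X` that comes from a subobject of `X`, encoded as the range of the image of
some morphism with target `X`. -/
def IsSub {X : C} (p : Submodule R (E.obj X)) : Prop :=
  ∃ (A : C) (a : A ⟶ X), LinearMap.range (E.map a).hom = p

namespace IsSub

variable {X Y : C} {p q : Submodule R (E.obj X)}

omit [Abelian C] [Linear R C] [IsExactEmbedding E] in
theorem range (f : X ⟶ Y) : IsSub E (LinearMap.range (E.map f).hom) := ⟨X, f, rfl⟩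

theorem ker (f : X ⟶ Y) : IsSub E (LinearMap.ker (E.map f).hom) := ⟨_, _, range_kernel_ι E f⟩

omit [Abelian C] [Linear R C] [IsExactEmbedding E] in
theorem map (hp : IsSub E p) (f : X ⟶ Y) : IsSub E (p.map (E.map f).hom) := by
  obtain ⟨A, a, rfl⟩ := hp
  exact ⟨A, a ≫ f, by rw [E.map_comp, ModuleCat.hom_comp, LinearMap.range_comp]⟩

theorem exists_ker_eq (hp : IsSub E p) :
    ∃ (Z : C) (g : X ⟶ Z), LinearMap.ker (E.map g).hom = p := by
  obtain ⟨A, a, rfl⟩ := hp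
  exact ⟨_, cokernel.π a, ker_cokernel_π E a⟩

theorem comap {p : Submodule R (E.obj Y)} (hp : IsSub E p) (f : X ⟶ Y) :
    IsSub E (p.comap (E.map f).hom) := by
  obtain ⟨Z, g, rfl⟩ := hp.exists_ker_eq
  rw [← LinearMap.ker_comp, ← ModuleCat.hom_comp, ← E.map_comp]
  exact ker _

theorem inf (hp : IsSub E p) (hq : IsSub E q) : IsSub E (p ⊓ q) := by
  obtain ⟨A, a, rfl⟩ := hp
  rw [← Submodule.map_comap_eq]
  exact (hq.comap a).map a

theorem bot : IsSub E (⊥ : Submodule R (E.obj X)) :=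
  ⟨X, 0, by rw [E.map_zero]; exact LinearMap.range_zero⟩

omit [Abelian C] [Linear R C] [IsExactEmbedding E] in
theorem top : IsSub E (⊤ : Submodule R (E.obj X)) :=
  ⟨X, 𝟙 X, by rw [E.map_id]; exact LinearMap.range_id⟩

theorem sup (hp : IsSub E p) (hq : IsSub E q) : IsSub E (p ⊔ q) := by
  obtain ⟨A, a, rfl⟩ := hp
  obtain ⟨B, b, rfl⟩ := hq
  refine ⟨A ⊞ B, biprod.desc a b, le_antisymm ?_ (sup_le ?_ ?_)⟩
  · rintro _ ⟨z, rfl⟩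
    rw [biprod.desc_eq, E.map_add, E.map_comp, E.map_comp]
    exact Submodule.add_mem_sup ⟨E.map biprod.fst z, rfl⟩ ⟨E.map biprod.snd z, rfl⟩
  · rintro _ ⟨x, rfl⟩
    refine ⟨E.map biprod.inl x, ?_⟩
    rw [← LinearMap.comp_apply, ← ModuleCat.hom_comp, ← E.map_comp, biprod.inl_desc]
  · rintro _ ⟨x, rfl⟩
    refine ⟨E.map biprod.inr x, ?_⟩
    rw [← LinearMap.comp_apply, ← ModuleCat.hom_comp, ← E.map_comp, biprod.inr_desc]

theorem iSup {ι : Type*} [Finite ι] {p : ι → Submodule R (E.obj X)} (hp : ∀ i, IsSub E (p i)) :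
    IsSub E (⨆ i, p i) := by
  have := Fintype.ofFinite ι
  rw [← Finset.sup_univ_eq_iSup]
  exact Finset.sup_induction bot (fun _ h _ h' => h.sup h') fun i _ => hp i

/-- Multiplying by a finitely generated ideal preserves submodules coming from subobjects. -/
theorem smul {I : Ideal R} (hI : I.FG) (hp : IsSub E p) : IsSub E (I • p) := by
  obtain ⟨S, rfl⟩ := hI
  have : Ideal.span (S : Set R) • p = ⨆ s : S, p.map (E.map ((s : R) • 𝟙 X)).hom := by
    refine le_antisymm (Submodule.smul_le.2 fun r hr x hx => ?_) (iSup_le fun s => ?_)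
    · have : Ideal.span (S : Set R) ≤ Submodule.comap (LinearMap.toSpanSingleton R _ x)
          (⨆ s : S, p.map (E.map ((s : R) • 𝟙 X)).hom) := by
        refine Submodule.span_le.2 fun s hs => ?_
        refine Submodule.mem_iSup_of_mem ⟨s, hs⟩ ⟨x, hx, ?_⟩
        exact smul_id_apply s x
      exact this hr
    · rintro _ ⟨x, hx, rfl⟩
      refine (smul_id_apply (s : R) x).symm ▸ Submodule.smul_mem_smul (Ideal.subset_span s.2) hx
  rw [this]
  exact iSup fun s => hp.map _

/-- The ascending chain condition on submodules coming from subobjects of a noetherian object. -/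
theorem exists_forall_eq_of_monotone [IsNoetherianObject X] (P : ℕ →o Submodule R (E.obj X))
    (hP : ∀ n, IsSub E (P n)) : ∃ n, ∀ m, n ≤ m → P n = P m := by
  choose Z g hg using fun n => (hP n).exists_ker_eq
  have hr (n : ℕ) : LinearMap.range (E.map (kernelSubobject (g n)).arrow).hom = P n := by
    rw [← hg, ← range_kernel_ι, ← kernelSubobject_arrow, E.map_comp, ModuleCat.hom_comp]
    exact LinearMap.range_comp_of_range_eq_top _
      (LinearMap.range_eq_top.2 ((epi_iff_surjective E _).1 inferInstance))
  let Q : ℕ →o Subobject X :=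
    { toFun n := kernelSubobject (g n)
      monotone' n m h := by
        refine le_kernelSubobject _ _ ((map_eq_zero_iff E _).1 fun x => ?_)
        rw [E.map_comp]
        have : E.map (kernelSubobject (g n)).arrow x ∈ LinearMap.ker (E.map (g m)).hom := by
          rw [hg]
          refine P.monotone h ?_
          rw [← hr]
          exact ⟨x, rfl⟩
        exact this }
  obtain ⟨n, hn⟩ := monotone_chain_condition_of_isNoetherianObject Q
  refine ⟨n, fun m hm => ?_⟩
  rw [← hr, ← hr, show kernelSubobject (g n) = kernelSubobject (g m) from hn m hm]

end IsSub

variable (E) in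
/-- A quotient whose kernel is `I M` on the level of modules is the reduction of `M`. -/
theorem isReduction_of_ker {I : Ideal R} {M Q : C} (π : M ⟶ Q) [Epi π]
    (h : LinearMap.ker (E.map π).hom = I • ⊤) : IsReduction I π := by
  refine IsReduction.of_epi (fun r hr => (map_eq_zero_iff E _).1 fun x => ?_) fun X f hf =>
    exists_desc E π f ?_
  · rw [map_smul_apply]
    have : r • x ∈ LinearMap.ker (E.map π).hom := by
      rw [h]
      exact Submodule.smul_mem_smul hr trivial
    simpa using this
  · rw [h, Submodule.smul_le]
    intro r hr x _
    have := (map_eq_zero_iff E _).2 (hf r hr) x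
    rw [map_smul_apply] at this
    simpa using this

variable (E) in
/-- Reductions modulo finitely generated ideals exist in abelian categories. -/
theorem exists_reduction_of_fg {I : Ideal R} (hI : I.FG) (M : C) :
    ∃ (Q : C) (π : M ⟶ Q), IsReduction I π ∧ LinearMap.ker (E.map π).hom = I • ⊤ := by
  obtain ⟨Z, g, hg⟩ := (IsSub.top.smul hI : IsSub E (I • (⊤ : Submodule R (E.obj M)))).exists_ker_eq
  have : LinearMap.ker (E.map (factorThruImage g)).hom = I • ⊤ := by
    rw [← hg]
    conv_rhs => rw [← image.fac g, E.map_comp, ModuleCat.hom_comp]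
    rw [LinearMap.ker_comp_of_ker_eq_bot]
    exact LinearMap.ker_eq_bot.2 ((mono_iff_injective E (image.ι g)).1 inferInstance)
  exact ⟨_, _, isReduction_of_ker E _ this, this⟩

theorem IsReduction.ker_eq {I : Ideal R} (hI : I.FG) {M Q : C} {π : M ⟶ Q} (h : IsReduction I π) :
    LinearMap.ker (E.map π).hom = I • ⊤ := by
  obtain ⟨Q', π', h', hk⟩ := exists_reduction_of_fg E hI M
  obtain ⟨e, rfl⟩ := h.exists_iso h'
  rw [← hk, E.map_comp, ModuleCat.hom_comp, LinearMap.ker_comp_of_ker_eq_bot]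
  exact LinearMap.ker_eq_bot.2 ((mono_iff_injective E e.hom).1 inferInstance)

instance (J : Ideal R) [IsNoetherianRing R] : HasReductions J C where
  exists_reduction n M := by
    obtain ⟨E, _⟩ := exists_isExactEmbedding R C
    obtain ⟨Q, π, h, -⟩ := exists_reduction_of_fg E (IsNoetherian.noetherian (J ^ n)) M
    exact ⟨Q, π, h⟩

end Embedding

/-! ### The basis theorem for graded objects -/

section Basis

variable {R : Type w} [CommRing R] {C : Type u} [Category.{v} C] [Abelian C] [Linear R C]
  {E : C ⥤ ModuleCat.{max u v} R} {X : ℕ → C} {ι : Type*}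

/-- A graded submodule of the graded module `g`, on which operators `t l` of degree one act: each
component comes from a subobject, and the family is stable under all operators and contains the
image of those not indexed by `s`. -/
structure IsGradedSub (E : C ⥤ ModuleCat.{max u v} R) (t : ι → ∀ i, X i ⟶ X (i + 1))
    (g : ∀ i, Submodule R (E.obj (X i))) (s : Finset ι)
    (p : ∀ i, Submodule R (E.obj (X i))) : Prop where
  isSub : ∀ i, IsSub E (p i)
  le : p ≤ g
  map_mem : ∀ l i, ∀ x ∈ p i, E.map (t l i) x ∈ p (i + 1)
  map_mem_of_notMem : ∀ l ∉ s, ∀ i, ∀ x ∈ g i, E.map (t l i) x ∈ p (i + 1)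

/-- The elements of `g` that the operator `a` sends into `p`. -/
def divSub (a : ∀ i, X i ⟶ X (i + 1)) (g p : ∀ i, Submodule R (E.obj (X i))) :
    ∀ i, Submodule R (E.obj (X i)) :=
  fun i => g i ⊓ (p (i + 1)).comap (E.map (a i)).hom

/-- The sum of `p` and the image of the operator `a`. -/
def addRange (a : ∀ i, X i ⟶ X (i + 1)) (g p : ∀ i, Submodule R (E.obj (X i))) :
    ∀ i, Submodule R (E.obj (X i))
  | 0 => p 0
  | i + 1 => p (i + 1) ⊔ (g i).map (E.map (a i)).hom

section

omit [Abelian C] [Linear R C]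

variable (a : ∀ i, X i ⟶ X (i + 1)) (g : ∀ i, Submodule R (E.obj (X i)))

theorem divSub_mono : Monotone (divSub a g) := fun _ _ h _ =>
  inf_le_inf_left _ (Submodule.comap_mono (h _))

theorem addRange_mono : Monotone (addRange a g) := fun _ _ h i =>
  match i with
  | 0 => h 0
  | i + 1 => sup_le_sup_right (h (i + 1)) _

/-- A graded submodule is determined by the sums of its iterated quotients by the operator `a` and
the image of `a`; this takes the place of leading coefficients in the basis theorem. -/
theorem eq_of_addRange_iterate_eq {p q : ∀ i, Submodule R (E.obj (X i))} (hpq : p ≤ q)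
    (h : ∀ k, addRange a g ((divSub a g)^[k] p) = addRange a g ((divSub a g)^[k] q)) : p = q := by
  have hle (k : ℕ) : (divSub a g)^[k] p ≤ (divSub a g)^[k] q := (divSub_mono a g).iterate k hpq
  suffices ∀ i k, (divSub a g)^[k] p i = (divSub a g)^[k] q i from funext fun i => this i 0
  intro i
  induction i with
  | zero => exact fun k => congrFun (h k) 0
  | succ i ih =>
    refine fun k => le_antisymm (hle k _) fun x hx => ?_
    have hx' : x ∈ addRange a g ((divSub a g)^[k] p) (i + 1) := by
      rw [h]
      exact Submodule.mem_sup_left hx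
    obtain ⟨y, hy, _, ⟨z, hz, rfl⟩, rfl⟩ := Submodule.mem_sup.1 hx'
    have hz' : z ∈ (divSub a g)^[k + 1] q i := by
      rw [Function.iterate_succ_apply']
      refine ⟨hz, ?_⟩
      exact (Submodule.add_mem_iff_right _ (hle k _ hy)).1 hx
    rw [← ih, Function.iterate_succ_apply'] at hz'
    exact Submodule.add_mem _ hy hz'.2

end

variable {t : ι → ∀ i, X i ⟶ X (i + 1)} {g : ∀ i, Submodule R (E.obj (X i))} {s : Finset ι}
  {p : ∀ i, Submodule R (E.obj (X i))}

/-- If the doubly monotone family `Q` stabilizes along the diagonal and in each row, it does so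
uniformly. -/
theorem exists_uniform_stable {α : Type*} [PartialOrder α]
    (Q : ℕ → ℕ → α) (h1 : ∀ k, Monotone (Q k)) (h2 : ∀ n, Monotone fun k => Q k n)
    (hd : ∃ n, ∀ m, n ≤ m → Q n n = Q m m) (hr : ∀ k, ∃ n, ∀ m, n ≤ m → Q k n = Q k m) :
    ∃ n, ∀ m, n ≤ m → ∀ k, Q k n = Q k m := by
  obtain ⟨n₀, h₀⟩ := hd
  choose N hN using hr
  -- beyond the diagonal bound `n₀`, only the finitely many rows `k < n₀` need separate bounds
  refine ⟨max n₀ ((Finset.range n₀).sup N), fun m hm k => ?_⟩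
  by_cases hk : k < n₀
  · have : N k ≤ max n₀ ((Finset.range n₀).sup N) :=
      (Finset.le_sup (Finset.mem_range.2 hk)).trans (le_max_right _ _)
    rw [← hN k _ this, ← hN k _ (this.trans hm)]
  · have key (m : ℕ) (hm : n₀ ≤ m) : Q k m = Q n₀ n₀ := by
      refine le_antisymm ?_ ((h1 _ hm).trans (h2 _ (not_lt.1 hk)))
      rw [h₀ (max k m) (hm.trans (le_max_right _ _))]
      exact (h1 _ (le_max_right k m)).trans (h2 _ (le_max_left k m))
    rw [key _ (le_max_left _ _), key _ ((le_max_left _ _).trans hm)]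

namespace IsGradedSub

omit [Abelian C] [Linear R C] in
theorem le_divSub (hp : IsGradedSub E t g s p) (l : ι) : p ≤ divSub (t l) g p :=
  fun i x hx => ⟨hp.le i hx, hp.map_mem l i x hx⟩

variable [IsExactEmbedding E]

theorem divSub (hp : IsGradedSub E t g s p) (hg : IsGradedSub E t g s g)
    (ht : ∀ l l' i, t l i ≫ t l' (i + 1) = t l' i ≫ t l (i + 1)) (l : ι) :
    IsGradedSub E t g s (divSub (t l) g p) := by
  have comm (l' i) (x : E.obj (X i)) : E.map (t l (i + 1)) (E.map (t l' i) x) =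
      E.map (t l' (i + 1)) (E.map (t l i) x) := by
    rw [← ConcreteCategory.comp_apply, ← ConcreteCategory.comp_apply, ← E.map_comp, ← E.map_comp,
      ht]
  refine ⟨fun i => (hg.isSub i).inf ((hp.isSub _).comap _), fun i => inf_le_left,
    fun l' i x hx => ⟨hg.map_mem l' i x hx.1, ?_⟩,
    fun l' hl' i x hx => ⟨hg.map_mem l' i x hx, ?_⟩⟩
  · change E.map (t l (i + 1)) (E.map (t l' i) x) ∈ p (i + 1 + 1)
    rw [comm]
    exact hp.map_mem l' _ _ hx.2
  · change E.map (t l (i + 1)) (E.map (t l' i) x) ∈ p (i + 1 + 1)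
    rw [comm]
    exact hp.map_mem_of_notMem l' hl' _ _ (hg.map_mem l i x hx)

theorem addRange [DecidableEq ι] {l : ι} (hp : IsGradedSub E t g (insert l s) p)
    (hg : IsGradedSub E t g s g)
    (ht : ∀ l l' i, t l i ≫ t l' (i + 1) = t l' i ≫ t l (i + 1)) :
    IsGradedSub E t g s (addRange (t l) g p) := by
  have hle : p ≤ AdicCompletionCat.addRange (t l) g p := fun i => match i with
    | 0 => le_rfl
    | i + 1 => le_sup_left
  refine ⟨fun i => ?_, fun i => ?_, fun l' i x hx => ?_, fun l' hl' i x hx => ?_⟩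
  · cases i with
    | zero => exact hp.isSub 0
    | succ i => exact (hp.isSub _).sup ((hg.isSub i).map _)
  · cases i with
    | zero => exact hp.le 0
    | succ i =>
      refine sup_le (hp.le _) ?_
      rintro _ ⟨x, hx, rfl⟩
      exact hg.map_mem l i x hx
  · cases i with
    | zero => exact hle _ (hp.map_mem l' 0 x hx)
    | succ i =>
      obtain ⟨y, hy, _, ⟨z, hz, rfl⟩, rfl⟩ := Submodule.mem_sup.1 hx
      rw [map_add]
      refine Submodule.add_mem_sup (hp.map_mem l' _ _ hy)
        ⟨E.map (t l' i) z, hg.map_mem l' i z hz, ?_⟩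
      change E.map (t l (i + 1)) (E.map (t l' i) z) = E.map (t l' (i + 1)) (E.map (t l i) z)
      rw [← ConcreteCategory.comp_apply, ← ConcreteCategory.comp_apply, ← E.map_comp,
        ← E.map_comp, ht]
  · by_cases h : l' = l
    · subst h
      exact Submodule.mem_sup_right ⟨x, hx, rfl⟩
    · exact hle _ (hp.map_mem_of_notMem l' (by simp [h, hl']) i x hx)

/-- The basis theorem: if `g` is generated in degree zero by finitely many commuting operators of
degree one and the objects are noetherian, then the graded submodules of `g` that come from
subobjects satisfy the ascending chain condition. -/
theorem exists_forall_eq_of_monotone [∀ i, IsNoetherianObject (X i)] [Finite ι]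
    (ht : ∀ l l' i, t l i ≫ t l' (i + 1) = t l' i ≫ t l (i + 1))
    (hg : ∀ i, IsSub E (g i)) (hmap : ∀ l i, ∀ x ∈ g i, E.map (t l i) x ∈ g (i + 1))
    (hgen : ∀ i, g (i + 1) ≤ ⨆ l, (g i).map (E.map (t l i)).hom)
    (s : Finset ι) (P : ℕ →o ∀ i, Submodule R (E.obj (X i)))
    (hP : ∀ n, IsGradedSub E t g s (P n)) : ∃ n, ∀ m, n ≤ m → P n = P m := by
  classical
  have hg' (s : Finset ι) : IsGradedSub E t g s g := ⟨hg, le_rfl, hmap, fun l _ => hmap l⟩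
  induction s using Finset.induction_on generalizing P with
  | empty =>
    obtain ⟨n, hn⟩ := IsSub.exists_forall_eq_of_monotone
      (⟨fun n => P n 0, fun _ _ h => P.monotone h 0⟩ : ℕ →o Submodule R (E.obj (X 0)))
      fun n => (hP n).isSub 0
    -- in positive degrees, all members of the chain are equal to `g`
    have key (m i : ℕ) : P m (i + 1) = g (i + 1) := by
      refine le_antisymm ((hP m).le _) ((hgen i).trans (iSup_le fun l => ?_))
      rintro _ ⟨x, hx, rfl⟩
      exact (hP m).map_mem_of_notMem l (by simp) i x hx
    refine ⟨n, fun m hm => funext fun i => ?_⟩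
    cases i with
    | zero => exact hn m hm
    | succ i => rw [key, key]
  | insert l s hl ih =>
    -- the quotients `Q k` by the image of `t l` are stable under one operator less
    let D := AdicCompletionCat.divSub (t l) g
    let B := AdicCompletionCat.addRange (t l) g
    have hD (k n : ℕ) : IsGradedSub E t g (insert l s) (D^[k] (P n)) := by
      induction k with
      | zero => exact hP n
      | succ k ih =>
        rw [Function.iterate_succ_apply']
        exact ih.divSub (hg' _) ht l
    let Q (k n : ℕ) := B (D^[k] (P n))
    have hQ (k n : ℕ) : IsGradedSub E t g s (Q k n) := (hD k n).addRange (hg' _) ht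
    have h1 (k : ℕ) : Monotone (Q k) := fun n m h =>
      addRange_mono _ _ ((divSub_mono _ _).iterate k (P.monotone h))
    have h2 (n : ℕ) : Monotone fun k => Q k n := monotone_nat_of_le_succ fun k => by
      refine addRange_mono _ _ ?_
      rw [Function.iterate_succ_apply']
      exact (hD k n).le_divSub l
    obtain ⟨n, hn⟩ := exists_uniform_stable Q h1 h2
      (ih ⟨fun n => Q n n, fun n m h => (h1 n h).trans (h2 m h)⟩ fun n => hQ n n)
      fun k => ih ⟨Q k, h1 k⟩ fun n => hQ k n
    exact ⟨n, fun m hm => eq_of_addRange_iterate_eq (t l) g (P.monotone hm) fun k => hn m hm k⟩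

end IsGradedSub

end Basis

/-! ### The Artin–Rees lemma for adic towers -/

section ArtinRees

variable {R : Type w} [CommRing R] {C : Type u} [Category.{v} C]

/-- The transition morphism `Tₘ ⟶ Tₙ` of a tower, for `n ≤ m`. -/
abbrev towerMap (T : ℕᵒᵖ ⥤ C) {n m : ℕ} (h : n ≤ m) : T.obj (op m) ⟶ T.obj (op n) :=
  T.map (homOfLE h).op

theorem towerMap_comp (T : ℕᵒᵖ ⥤ C) {n m l : ℕ} (h : n ≤ m) (h' : m ≤ l) :
    towerMap T h' ≫ towerMap T h = towerMap T (h.trans h') :=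
  (T.map_comp _ _).symm

variable [Abelian C] [Linear R C] {E : C ⥤ ModuleCat.{max u v} R} {J : Ideal R}
  {N : ℕᵒᵖ ⥤ C}

/-- A subtower of `N` with surjective transition maps, on the level of modules. -/
structure IsSubtower (E : C ⥤ ModuleCat.{max u v} R) (N : ℕᵒᵖ ⥤ C)
    (u : ∀ n : ℕ, Submodule R (E.obj (N.obj (op n)))) : Prop where
  isSub : ∀ n, IsSub E (u n)
  map_eq : ∀ n, (u (n + 1)).map (E.map (towerMap N n.le_succ)).hom = u n

/-- The associated graded family of a subtower. -/
def grSub (E : C ⥤ ModuleCat.{max u v} R) (N : ℕᵒᵖ ⥤ C)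
    (u : ∀ n : ℕ, Submodule R (E.obj (N.obj (op n)))) (i : ℕ) :
    Submodule R (E.obj (N.obj (op (i + 1)))) :=
  u (i + 1) ⊓ LinearMap.ker (E.map (towerMap N i.le_succ)).hom

section

omit [Abelian C] [Linear R C]

theorem grSub_mono : Monotone (grSub E N) := fun _ _ h i => inf_le_inf_right _ (h (i + 1))

theorem mem_grSub {u : ∀ n : ℕ, Submodule R (E.obj (N.obj (op n)))} {i : ℕ}
    {x : E.obj (N.obj (op (i + 1)))} :
    x ∈ grSub E N u i ↔ x ∈ u (i + 1) ∧ E.map (towerMap N i.le_succ) x = 0 := Iff.rfl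

end

omit [Abelian C] [Linear R C] in
theorem map_comp_apply {X Y Z : C} (f : X ⟶ Y) (g : Y ⟶ Z) (x : E.obj X) :
    E.map (f ≫ g) x = E.map g (E.map f x) := by
  rw [E.map_comp]
  rfl

variable [IsExactEmbedding E]

theorem isAdicTower.epi_towerMap (hN : isAdicTower J C N) {n m : ℕ} (h : n ≤ m) :
    Epi (towerMap N h) := (hN (homOfLE h).op).epi

theorem isAdicTower.surjective (hN : isAdicTower J C N) {n m : ℕ} (h : n ≤ m) :
    Function.Surjective (E.map (towerMap N h)) :=
  (epi_iff_surjective E _).1 (hN.epi_towerMap h)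

theorem isAdicTower.smul_eq_zero (hN : isAdicTower J C N) {n : ℕ} {r : R} (hr : r ∈ J ^ n)
    (x : E.obj (N.obj (op n))) : r • x = 0 := by
  rw [← smul_id_apply, hN.smul_id_eq_zero (op n) r hr]
  exact (map_eq_zero_iff E _).2 rfl x

theorem isAdicTower.smul_top_eq_bot (hN : isAdicTower J C N) (n : ℕ) :
    J ^ n • (⊤ : Submodule R (E.obj (N.obj (op n)))) = ⊥ :=
  le_bot_iff.1 (Submodule.smul_le.2 fun _ hr x _ => hN.smul_eq_zero hr x)

theorem isAdicTower.ker_eq [IsNoetherianRing R] (hN : isAdicTower J C N) {n m : ℕ} (h : n ≤ m) :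
    LinearMap.ker (E.map (towerMap N h)).hom = J ^ n • ⊤ :=
  (hN (homOfLE h).op).ker_eq (IsNoetherian.noetherian _)

theorem isAdicTower.isSubtower_top (hN : isAdicTower J C N) : IsSubtower E N (fun _ => ⊤) :=
  ⟨fun _ => IsSub.top, fun n => by
    rw [Submodule.map_top]
    exact LinearMap.range_eq_top.2 (hN.surjective n.le_succ)⟩

/-- A subtower of an adic tower is determined by its associated graded family. -/
theorem IsSubtower.eq_of_grSub_eq (hN : isAdicTower J C N)
    {u u' : ∀ n : ℕ, Submodule R (E.obj (N.obj (op n)))} (hu : IsSubtower E N u)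
    (hu' : IsSubtower E N u') (hle : u ≤ u') (h : grSub E N u = grSub E N u') : u = u' := by
  refine le_antisymm hle fun n => ?_
  induction n with
  | zero =>
    intro x _
    have : x = 0 := by
      rw [← one_smul R x]
      exact hN.smul_eq_zero (by simp) x
    rw [this]
    exact zero_mem _
  | succ n ih =>
    intro x hx
    have hx' : E.map (towerMap N n.le_succ) x ∈ u' n := by
      rw [← hu'.map_eq]
      exact ⟨x, hx, rfl⟩
    have hx'' := ih hx'
    rw [← hu.map_eq] at hx''
    obtain ⟨y, hy, hxy⟩ := hx''
    have : x - y ∈ grSub E N u' n := by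
      refine mem_grSub.2 ⟨sub_mem hx (hle _ hy), ?_⟩
      rw [map_sub, sub_eq_zero]
      exact hxy.symm
    rw [← h] at this
    simpa using add_mem this.1 hy

/-- The operators on the associated graded object of an adic tower given by finitely many
generators of the ideal: multiplication by `r ∈ J` on `Nᵢ₊₂` descends to `Nᵢ₊₁ ⟶ Nᵢ₊₂`. -/
theorem isAdicTower.exists_operators [IsNoetherianRing R] (hN : isAdicTower J C N) :
    ∃ (ι : Type w) (_ : Finite ι) (r : ι → R)
      (t : ι → ∀ i : ℕ, N.obj (op (i + 1)) ⟶ N.obj (op (i + 1 + 1))),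
      (∀ l, r l ∈ J) ∧ (∀ l i, towerMap N (i + 1).le_succ ≫ t l i = r l • 𝟙 _) ∧
      ∀ i, LinearMap.ker (E.map (towerMap N (i + 1).le_succ)).hom ≤
        ⨆ l, (LinearMap.ker (E.map (towerMap N i.le_succ)).hom).map (E.map (t l i)).hom := by
  obtain ⟨S, hS⟩ := (IsNoetherian.noetherian J : J.FG)
  have (l : S) (i : ℕ) : ∃ t : N.obj (op (i + 1)) ⟶ N.obj (op (i + 1 + 1)),
      towerMap N (i + 1).le_succ ≫ t = (l : R) • 𝟙 _ :=
    ((hN (homOfLE (i + 1).le_succ).op).existsUnique_desc _ fun s hs => by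
      rw [smul_smul]
      refine hN.smul_id_eq_zero _ _ ?_
      rw [pow_succ]
      exact Ideal.mul_mem_mul hs (hS ▸ Submodule.subset_span l.2)).exists
  choose t ht using this
  refine ⟨S, inferInstance, fun l => l, t, fun l => hS ▸ Submodule.subset_span l.2, ht,
    fun i => ?_⟩
  rw [hN.ker_eq, pow_succ', mul_smul, Submodule.smul_le]
  intro r hr x hx
  have hle : J ≤ Submodule.comap (LinearMap.toSpanSingleton R _ x)
      (⨆ l, (LinearMap.ker (E.map (towerMap N i.le_succ)).hom).map (E.map (t l i)).hom) := by
    rw [← hS]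
    refine Submodule.span_le.2 fun s hs => ?_
    refine Submodule.mem_iSup_of_mem ⟨s, hs⟩ ⟨E.map (towerMap N (i + 1).le_succ) x, ?_, ?_⟩
    · rw [hN.ker_eq]
      exact Submodule.smul_top_le_comap_smul_top _ _ hx
    · change E.map (t ⟨s, hs⟩ i) (E.map (towerMap N (i + 1).le_succ) x) = s • x
      rw [← map_comp_apply, ht, smul_id_apply]
  exact hle hr

/-- The associated graded family of a subtower is a graded submodule of that of the tower. -/
theorem IsSubtower.isGradedSub (hN : isAdicTower J C N)
    {u : ∀ n : ℕ, Submodule R (E.obj (N.obj (op n)))} (hu : IsSubtower E N u)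
    [IsNoetherianRing R] {ι : Type*} [Fintype ι] {r : ι → R}
    {t : ι → ∀ i : ℕ, N.obj (op (i + 1)) ⟶ N.obj (op (i + 1 + 1))} (hr : ∀ l, r l ∈ J)
    (ht : ∀ l i, towerMap N (i + 1).le_succ ≫ t l i = r l • 𝟙 _) :
    IsGradedSub E t (fun i => LinearMap.ker (E.map (towerMap N i.le_succ)).hom) Finset.univ
      (grSub E N u) where
  isSub i := (hu.isSub _).inf (IsSub.ker _)
  le i := inf_le_right
  map_mem l i x hx := by
    obtain ⟨hx, hx'⟩ := hx
    rw [← hu.map_eq] at hx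
    obtain ⟨y, hy, rfl⟩ := hx
    change E.map (t l i) (E.map _ y) ∈ _
    rw [← map_comp_apply, ht, smul_id_apply]
    refine mem_grSub.2 ⟨Submodule.smul_mem _ _ hy, ?_⟩
    rw [hN.ker_eq] at hx'
    have h0 : r l • E.map (towerMap N (i + 1).le_succ) y ∈
        J ^ (i + 1) • (⊤ : Submodule R (E.obj (N.obj (op (i + 1))))) := by
      rw [pow_succ', mul_smul]
      exact Submodule.smul_mem_smul (hr l) hx'
    rw [hN.smul_top_eq_bot] at h0
    rw [map_smul]
    exact h0
  map_mem_of_notMem l hl := absurd (Finset.mem_univ l) hl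

/-- The subfamily of `p` generated by its components in degrees at most `d`. -/
def truncSub {X : ℕ → C} {ι : Type*} (t : ι → ∀ i, X i ⟶ X (i + 1))
    (p : ∀ i, Submodule R (E.obj (X i))) (d : ℕ) : ∀ i, Submodule R (E.obj (X i))
  | 0 => p 0
  | i + 1 => if i + 1 ≤ d then p (i + 1) else
      ⨆ l, (truncSub t p d i).map (E.map (t l i)).hom

/-- Graded submodules are generated in bounded degrees. -/
theorem IsGradedSub.exists_generated {X : ℕ → C} [∀ i, IsNoetherianObject (X i)] {ι : Type*}
    [Finite ι] {t : ι → ∀ i, X i ⟶ X (i + 1)} {g p : ∀ i, Submodule R (E.obj (X i))} {s : Finset ι}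
    (ht : ∀ l l' i, t l i ≫ t l' (i + 1) = t l' i ≫ t l (i + 1))
    (hg : ∀ i, IsSub E (g i)) (hmap : ∀ l i, ∀ x ∈ g i, E.map (t l i) x ∈ g (i + 1))
    (hgen : ∀ i, g (i + 1) ≤ ⨆ l, (g i).map (E.map (t l i)).hom) (hs : ∀ l, l ∈ s)
    (hp : IsGradedSub E t g s p) :
    ∃ d, ∀ i, d ≤ i → p (i + 1) ≤ ⨆ l, (p i).map (E.map (t l i)).hom := by
  have hpt (i : ℕ) : ⨆ l, (p i).map (E.map (t l i)).hom ≤ p (i + 1) := iSup_le fun l => by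
    rintro _ ⟨x, hx, rfl⟩
    exact hp.map_mem l i x hx
  have hsucc {d i : ℕ} (h : d ≤ i) : truncSub t p d (i + 1) =
      ⨆ l, (truncSub t p d i).map (E.map (t l i)).hom := by
    rw [truncSub, if_neg (by omega)]
  have heq {d i : ℕ} (h : i ≤ d) : truncSub t p d i = p i := by
    cases i with
    | zero => rfl
    | succ i => rw [truncSub, if_pos h]
  have hle (d i : ℕ) : truncSub t p d i ≤ p i := by
    induction i with
    | zero => exact le_rfl
    | succ i ih =>
      rcases le_or_gt (i + 1) d with h | h
      · rw [heq h]
      · rw [hsucc (Nat.lt_succ_iff.1 h)]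
        exact (iSup_mono fun l => Submodule.map_mono ih).trans (hpt i)
  have hmono : Monotone (truncSub t p) := monotone_nat_of_le_succ fun d i => by
    induction i with
    | zero => exact le_rfl
    | succ i ih =>
      rcases le_or_gt (i + 1) (d + 1) with h | h
      · rw [heq h]
        exact hle _ _
      · rw [hsucc (Nat.lt_succ_iff.1 h), hsucc (by omega)]
        exact iSup_mono fun l => Submodule.map_mono ih
  have hsub (d : ℕ) : IsGradedSub E t g s (truncSub t p d) := by
    refine ⟨fun i => ?_, fun i => (hle d i).trans (hp.le i), fun l i x hx => ?_,
      fun l hl => absurd (hs l) hl⟩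
    · induction i with
      | zero => exact hp.isSub 0
      | succ i ih =>
        rcases le_or_gt (i + 1) d with h | h
        · rw [heq h]
          exact hp.isSub _
        · rw [hsucc (Nat.lt_succ_iff.1 h)]
          exact IsSub.iSup fun l => ih.map _
    · rcases le_or_gt (i + 1) d with h | h
      · rw [heq h]
        exact hp.map_mem l i x (hle d i hx)
      · rw [hsucc (Nat.lt_succ_iff.1 h)]
        exact Submodule.mem_iSup_of_mem l ⟨x, hx, rfl⟩
  obtain ⟨d, hd⟩ := exists_forall_eq_of_monotone ht hg hmap hgen s ⟨_, hmono⟩ hsub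
  refine ⟨d, fun i hi => ?_⟩
  have h1 : truncSub t p d = truncSub t p i := hd i hi
  have h2 : truncSub t p d = truncSub t p (i + 1) := hd (i + 1) (by omega)
  rw [← heq le_rfl, ← h2, h1, hsucc le_rfl, heq le_rfl]

section

variable [IsNoetherianRing R] [∀ X : C, IsNoetherianObject X] (hN : isAdicTower J C N)

include hN

omit [IsNoetherianRing R] [∀ X : C, IsNoetherianObject X] in
theorem isAdicTower.operators_comm {ι : Type*} {r : ι → R}
    {t : ι → ∀ i : ℕ, N.obj (op (i + 1)) ⟶ N.obj (op (i + 1 + 1))}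
    (ht : ∀ l i, towerMap N (i + 1).le_succ ≫ t l i = r l • 𝟙 _) (l l' : ι) (i : ℕ) :
    t l i ≫ t l' (i + 1) = t l' i ≫ t l (i + 1) := by
  have := hN.epi_towerMap (i + 1).le_succ
  have := hN.epi_towerMap (i + 1 + 1).le_succ
  rw [← cancel_epi (towerMap N (i + 1).le_succ), reassoc_of% ht, reassoc_of% ht,
    ← cancel_epi (towerMap N (i + 1 + 1).le_succ)]
  simp only [Linear.smul_comp, Linear.comp_smul, Category.id_comp]
  rw [ht, ht, smul_comm]

/-- The ascending chain condition for subtowers of an adic tower. -/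
theorem exists_forall_eq_of_monotone_subtower
    (u : ℕ →o ∀ n : ℕ, Submodule R (E.obj (N.obj (op n)))) (hu : ∀ k, IsSubtower E N (u k)) :
    ∃ n, ∀ m, n ≤ m → u n = u m := by
  obtain ⟨ι, _, r, t, hr, ht, hgen⟩ := hN.exists_operators (E := E)
  have := Fintype.ofFinite ι
  obtain ⟨n, hn⟩ := IsGradedSub.exists_forall_eq_of_monotone (hN.operators_comm ht)
    (fun i => IsSub.ker _) (fun l i x hx =>
      ((hN.isSubtower_top.isGradedSub hN hr ht).map_mem l i x ⟨trivial, hx⟩).2) hgen Finset.univ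
    ⟨fun k => grSub E N (u k), fun _ _ h => grSub_mono (u.monotone h)⟩
    fun k => (hu k).isGradedSub hN hr ht
  exact ⟨n, fun m hm => (hu n).eq_of_grSub_eq hN (hu m) (u.monotone hm) (hn m hm)⟩

/-- The Artin–Rees lemma, for consecutive terms of a subtower. -/
theorem IsSubtower.exists_grSub_le {u : ∀ n : ℕ, Submodule R (E.obj (N.obj (op n)))}
    (hu : IsSubtower E N u) :
    ∃ d, ∀ n m, d + n ≤ m → grSub E N u m ≤ J ^ n • u (m + 1) := by
  obtain ⟨ι, _, r, t, hr, ht, hgen⟩ := hN.exists_operators (E := E)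
  have := Fintype.ofFinite ι
  obtain ⟨d, hd⟩ := (hu.isGradedSub hN hr ht).exists_generated (hN.operators_comm ht)
    (fun i => IsSub.ker _) (fun l i x hx =>
      ((hN.isSubtower_top.isGradedSub hN hr ht).map_mem l i x ⟨trivial, hx⟩).2) hgen Finset.mem_univ
  suffices ∀ n, grSub E N u (d + n) ≤ J ^ n • u (d + n + 1) by
    refine ⟨d, fun n m h => ?_⟩
    obtain ⟨k, rfl⟩ : ∃ k, m = d + (n + k) := ⟨m - (d + n), by omega⟩
    exact (this (n + k)).trans
      (Submodule.smul_mono_left (Ideal.pow_le_pow_right (Nat.le_add_right n k)))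
  intro n
  induction n with
  | zero =>
    rw [pow_zero, Ideal.one_eq_top, Submodule.top_smul]
    exact inf_le_left
  | succ n ih =>
    refine (hd (d + n) (Nat.le_add_right _ _)).trans (iSup_le fun l => ?_)
    rintro _ ⟨x, hx, rfl⟩
    have hx' := ih hx
    rw [← hu.map_eq, ← Submodule.map_smul''] at hx'
    obtain ⟨y, hy, rfl⟩ := hx'
    change E.map (t l (d + n)) (E.map _ y) ∈ _
    rw [← map_comp_apply, ht, smul_id_apply, pow_succ', mul_smul]
    exact Submodule.smul_mem_smul (hr l) hy

/-- The Artin–Rees lemma for a subtower of an adic tower. -/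
theorem IsSubtower.exists_ker_le {u : ∀ n : ℕ, Submodule R (E.obj (N.obj (op n)))}
    (hu : IsSubtower E N u) : ∃ d, ∀ n m (h : d + n ≤ m), ∀ x ∈ u m,
      E.map (towerMap N h) x = 0 → x ∈ J ^ n • u m := by
  obtain ⟨d, hd⟩ := hu.exists_grSub_le hN
  refine ⟨d, fun n m h => ?_⟩
  obtain ⟨k, rfl⟩ := Nat.exists_eq_add_of_le h
  induction k with
  | zero =>
    intro x _ hx
    have : towerMap N h = 𝟙 _ := N.map_id _
    rw [this, E.map_id] at hx
    rw [show x = 0 from hx]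
    exact zero_mem _
  | succ k ih =>
    intro x hx hx0
    have h' : E.map (towerMap N (d + n + k).le_succ) x ∈ J ^ n • u (d + n + k) := by
      refine ih (Nat.le_add_right _ _) _ ?_ ?_
      · rw [← hu.map_eq]
        exact ⟨x, hx, rfl⟩
      · rw [← map_comp_apply, towerMap_comp]
        exact hx0
    rw [← hu.map_eq, ← Submodule.map_smul''] at h'
    obtain ⟨y, hy, hxy⟩ := h'
    have : x - y ∈ grSub E N u (d + n + k) := by
      refine mem_grSub.2 ⟨sub_mem hx (Submodule.smul_le_right hy), ?_⟩
      rw [map_sub, sub_eq_zero]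
      exact hxy.symm
    have := add_mem (hd n _ (Nat.le_add_right _ _) this) hy
    rwa [sub_add_cancel] at this

end

end ArtinRees

/-! ### Adic towers form an abelian category -/

section AdicSub

variable {R : Type w} [CommRing R] [IsNoetherianRing R] {C : Type u} [Category.{v} C] [Abelian C]
  [Linear R C] {E : C ⥤ ModuleCat.{max u v} R} [IsExactEmbedding E] {J : Ideal R}

/-- There is a tower with terms `U_{d+n} / U_{d+n} Jⁿ`. -/
theorem exists_shiftTower (J : Ideal R) (U : ℕᵒᵖ ⥤ C) (d : ℕ) :
    ∃ (P : ℕᵒᵖ ⥤ C) (q : ∀ n : ℕ, U.obj (op (d + n)) ⟶ P.obj (op n)),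
      (∀ n, IsReduction (J ^ n) (q n)) ∧ ∀ {n m : ℕ} (h : n ≤ m),
        q m ≫ towerMap P h = towerMap U (Nat.add_le_add_left h d) ≫ q n :=
  ⟨{  obj n := red J n.unop (U.obj (op (d + n.unop)))
      map f := redMap (leOfHom f.unop) (towerMap U (Nat.add_le_add_left (leOfHom f.unop) d))
      map_id n := by
        rw [← redMap_id]
        congr 1
        exact U.map_id _
      map_comp f g := by
        rw [redMap_comp, towerMap_comp] },
    fun n => redπ J n _, fun n => isReduction_redπ J n _, fun h => redπ_map h _⟩

/-- If `U` satisfies the Artin–Rees condition with shift `d`, then the tower with terms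
`U_{d+n} / U_{d+n} Jⁿ` is adic. -/
theorem isAdicTower_of_shift {U P : ℕᵒᵖ ⥤ C} {d : ℕ}
    {q : ∀ n : ℕ, U.obj (op (d + n)) ⟶ P.obj (op n)} (hq : ∀ n, IsReduction (J ^ n) (q n))
    (hP : ∀ {n m : ℕ} (h : n ≤ m),
      q m ≫ towerMap P h = towerMap U (Nat.add_le_add_left h d) ≫ q n)
    (hU : ∀ {n m : ℕ} (h : n ≤ m), Epi (towerMap U h))
    (hd : ∀ n m (h : d + n ≤ m),
      LinearMap.ker (E.map (towerMap U h)).hom ≤ J ^ n • ⊤) :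
    isAdicTower J C P := fun ⟨n⟩ ⟨m⟩ f => by
  have h : n ≤ m := leOfHom f.unop
  change IsReduction (J ^ n) (towerMap P h)
  have hf := Nat.add_le_add_left h d
  have : Epi (towerMap P h) := by
    have := (hq n).epi
    have := hU hf
    have h := epi_comp (towerMap U hf) (q n)
    rw [← hP] at h
    exact epi_of_epi (q m) _
  refine isReduction_of_ker E _ (le_antisymm ?_ (Submodule.smul_le.2 fun r hr x _ => ?_))
  · intro z hz
    obtain ⟨x, rfl⟩ := (epi_iff_surjective E _).1 (hq m).epi z
    have hx : E.map (towerMap U hf) x ∈ LinearMap.ker (E.map (q n)).hom := by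
      change E.map (q n) _ = 0
      rw [← map_comp_apply, ← hP h, map_comp_apply]
      exact hz
    have htop : Submodule.map (E.map (towerMap U hf)).hom ⊤ = ⊤ := by
      rw [Submodule.map_top]
      exact LinearMap.range_eq_top.2 ((epi_iff_surjective E _).1 (hU hf))
    rw [(hq n).ker_eq (IsNoetherian.noetherian _), ← htop, ← Submodule.map_smul''] at hx
    obtain ⟨y, hy, hxy⟩ := hx
    have hxy' : x - y ∈ LinearMap.ker (E.map (towerMap U hf)).hom := by
      rw [LinearMap.mem_ker, map_sub, sub_eq_zero]
      exact hxy.symm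
    have := add_mem (hd _ _ hf hxy') hy
    rw [sub_add_cancel] at this
    exact Submodule.smul_top_le_comap_smul_top _ (E.map (q m)).hom this
  · have := (map_eq_zero_iff E _).2 ((hq n).smul_id_eq_zero r hr) (E.map (towerMap P h) x)
    rw [smul_id_apply] at this
    rw [LinearMap.mem_ker, map_smul]
    exact this

/-- A subtower `U` of an adic tower `N` with surjective transition maps has an associated adic
tower `P ⟶ N`, which has the same image in `N` and through which every morphism from an adic tower
to `N` with values in `U` factors. -/
theorem exists_adicSub [∀ X : C, IsNoetherianObject X] {N U : ℕᵒᵖ ⥤ C} (hN : isAdicTower J C N)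
    (i : U ⟶ N) (hi : ∀ n, Mono (i.app n)) (hU : ∀ {n m : ℕ} (h : n ≤ m), Epi (towerMap U h)) :
    ∃ (P : ℕᵒᵖ ⥤ C) (_ : isAdicTower J C P) (j : P ⟶ N),
      (∀ n, LinearMap.range (E.map (j.app n)).hom = LinearMap.range (E.map (i.app n)).hom) ∧
      (∀ n : ℕ, ∃ (m : ℕ) (h : n ≤ m), LinearMap.ker (E.map (j.app (op m))).hom ≤
        LinearMap.ker (E.map (towerMap P h)).hom) ∧
      ∀ (X : ℕᵒᵖ ⥤ C) (_ : isAdicTower J C X) (g : X ⟶ N),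
        (∀ n, LinearMap.range (E.map (g.app n)).hom ≤ LinearMap.range (E.map (i.app n)).hom) →
        ∃ k : X ⟶ P, k ≫ j = g := by
  have hinj (n : ℕᵒᵖ) := (mono_iff_injective E _).1 (hi n)
  have hsurj {n m : ℕ} (h : n ≤ m) := (epi_iff_surjective E _).1 (hU h)
  have nat {n m : ℕ} (h : n ≤ m) : i.app (op m) ≫ towerMap N h = towerMap U h ≫ i.app (op n) :=
    (i.naturality _).symm
  have hu : IsSubtower E N fun n => LinearMap.range (E.map (i.app (op n))).hom := by
    refine ⟨fun n => IsSub.range _, fun n => ?_⟩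
    rw [← LinearMap.range_comp, ← ModuleCat.hom_comp, ← E.map_comp, nat, E.map_comp,
      ModuleCat.hom_comp]
    exact LinearMap.range_comp_of_range_eq_top _ (LinearMap.range_eq_top.2 (hsurj n.le_succ))
  obtain ⟨d, hd⟩ := hu.exists_ker_le hN
  have hd' (n m : ℕ) (h : d + n ≤ m) : LinearMap.ker (E.map (towerMap U h)).hom ≤ J ^ n • ⊤ := by
    intro x hx
    have h1 := hd n m h (E.map (i.app (op m)) x) ⟨x, rfl⟩ (by
      rw [← map_comp_apply, nat, map_comp_apply]
      exact (congrArg _ hx).trans (map_zero _))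
    rw [LinearMap.range_eq_map, ← Submodule.map_smul''] at h1
    obtain ⟨y, hy, hxy⟩ := h1
    rwa [← hinj _ hxy]
  obtain ⟨P, q, hq, hqP⟩ := exists_shiftTower J U d
  have hP : isAdicTower J C P := isAdicTower_of_shift hq hqP hU hd'
  have hqe (n : ℕ) : Epi (q n) := (hq n).epi
  have hkill (n : ℕ) (r : R) (hr : r ∈ J ^ n) : r • 𝟙 (U.obj (op n)) = 0 := by
    have := hi (op n)
    rw [← cancel_mono (i.app (op n)), Linear.smul_comp, Category.id_comp, zero_comp,
      ← Category.comp_id (i.app (op n)), ← Linear.comp_smul, hN.smul_id_eq_zero (op n) r hr,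
      comp_zero]
  have (n : ℕ) : ∃ c : P.obj (op n) ⟶ U.obj (op n), q n ≫ c = towerMap U (Nat.le_add_left n d) :=
    ((hq n).existsUnique_desc (towerMap U (Nat.le_add_left n d)) fun r hr => by
      rw [← Category.comp_id (towerMap U _), ← Linear.comp_smul, hkill n r hr, comp_zero]).exists
  choose c hc using this
  have hcP {n m : ℕ} (h : n ≤ m) : towerMap P h ≫ c n = c m ≫ towerMap U h := by
    rw [← cancel_epi (q m), reassoc_of% (hqP h), hc, reassoc_of% (hc m), towerMap_comp,
      towerMap_comp]
  let j : P ⟶ N :=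
    { app n := c n.unop ≫ i.app n
      naturality := fun ⟨m⟩ ⟨n⟩ f => by
        have h : n ≤ m := leOfHom f.unop
        change towerMap P h ≫ c n ≫ i.app (op n) = (c m ≫ i.app (op m)) ≫ towerMap N h
        rw [reassoc_of% (hcP h), Category.assoc, nat] }
  refine ⟨P, hP, j, fun n => ?_, fun n => ⟨d + n, Nat.le_add_left n d, ?_⟩, fun X hX g hg => ?_⟩
  -- `j` and `i` have the same image, as `c n` is an epimorphism: `q n ≫ c n` is a transition map
  · have : Epi (c n.unop) := by
      have := hU (Nat.le_add_left n.unop d)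
      rw [← hc] at this
      exact epi_of_epi (q n.unop) _
    change LinearMap.range (E.map (c n.unop ≫ i.app n)).hom = _
    rw [E.map_comp, ModuleCat.hom_comp]
    exact LinearMap.range_comp_of_range_eq_top _
      (LinearMap.range_eq_top.2 ((epi_iff_surjective E _).1 this))
  · -- the transition morphism factors through `c`, hence the claim by injectivity of `i`
    have h1 : towerMap P (Nat.le_add_left n d) = c (d + n) ≫ q n := by
      rw [← cancel_epi (q (d + n)), hqP, reassoc_of% (hc (d + n))]
    intro x hx
    have hx0 : E.map (i.app (op (d + n))) (E.map (c (d + n)) x) = 0 := by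
      rw [← map_comp_apply]
      exact hx
    have hx1 : E.map (c (d + n)) x = 0 := hinj _ (hx0.trans (map_zero _).symm)
    change E.map (towerMap P _) x = 0
    rw [h1, map_comp_apply, hx1, map_zero]
  · have (n : ℕ) : ∃ g' : X.obj (op n) ⟶ U.obj (op n), g' ≫ i.app (op n) = g.app (op n) := by
      have := hi (op n)
      exact exists_lift E _ _ (hg _)
    choose g' hg' using this
    have hgn {n m : ℕ} (h : n ≤ m) : towerMap X h ≫ g' n = g' m ≫ towerMap U h := by
      have := hi (op n)
      rw [← cancel_mono (i.app (op n)), Category.assoc, hg', Category.assoc, ← nat,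
        reassoc_of% (hg' m)]
      exact g.naturality _
    have (n : ℕ) : ∃ k : X.obj (op n) ⟶ P.obj (op n),
        towerMap X (Nat.le_add_left n d) ≫ k = g' (d + n) ≫ q n :=
      ((hX (homOfLE (Nat.le_add_left n d)).op).existsUnique_desc (g' (d + n) ≫ q n) fun r hr => by
        rw [← Linear.comp_smul, (hq n).smul_eq_zero r hr, comp_zero]).exists
    choose k hk using this
    refine ⟨⟨fun n => k n.unop, ?_⟩, ?_⟩
    · rintro ⟨m⟩ ⟨n⟩ f
      have h : n ≤ m := leOfHom f.unop
      change towerMap X h ≫ k n = k m ≫ towerMap P h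
      have := hX.epi_towerMap (Nat.le_add_left m d)
      rw [← cancel_epi (towerMap X (Nat.le_add_left m d)), reassoc_of% (hk m), hqP,
        ← reassoc_of% (hgn (Nat.add_le_add_left h d)), ← hk, ← Category.assoc, ← Category.assoc,
        towerMap_comp, towerMap_comp]
    · ext ⟨n⟩
      change k n ≫ c n ≫ i.app (op n) = g.app (op n)
      have := hX.epi_towerMap (Nat.le_add_left n d)
      rw [← cancel_epi (towerMap X (Nat.le_add_left n d)), reassoc_of% (hk n), reassoc_of% (hc n),
        ← nat, reassoc_of% (hg' (d + n))]
      exact (g.naturality _).symm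

end AdicSub

section AbelianTowers

variable {R : Type w} [CommRing R] [IsNoetherianRing R] {C : Type u} [Category.{v} C] [Abelian C]
  [Linear R C] {E : C ⥤ ModuleCat.{max u v} R} [IsExactEmbedding E] {J : Ideal R}

omit [IsNoetherianRing R] in
theorem comp_app_eq_zero {X Y Z : AdicTower J C} {f : X ⟶ Y} {g : Y ⟶ Z} (h : f ≫ g = 0)
    (n : ℕᵒᵖ) : f.hom.app n ≫ g.hom.app n = 0 :=
  NatTrans.congr_app ((isAdicTower J C).ι.congr_map h) n

omit [IsNoetherianRing R] in
/-- A morphism of adic towers is a monomorphism as soon as its degreewise kernels are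
pro-zero. -/
theorem mono_of_ker_le {P N : AdicTower J C} (j : P ⟶ N)
    (h : ∀ n : ℕ, ∃ (m : ℕ) (h : n ≤ m), LinearMap.ker (E.map (j.hom.app (op m))).hom ≤
        LinearMap.ker (E.map (towerMap P.obj h)).hom) : Mono j :=
  Preadditive.mono_of_cancel_zero _ fun {X} g hg => by
    ext ⟨n⟩
    obtain ⟨m, hnm, hm⟩ := h n
    have := X.property.epi_towerMap hnm
    change g.hom.app (op n) = 0
    rw [← cancel_epi (towerMap X.obj hnm), comp_zero]
    refine (g.hom.naturality _).trans ((map_eq_zero_iff E _).1 fun x => ?_)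
    rw [map_comp_apply]
    refine hm ?_
    have h0 : g.hom.app (op m) ≫ j.hom.app (op m) = 0 :=
      comp_app_eq_zero hg (op m)
    have := (map_eq_zero_iff E _).2 h0 x
    rwa [map_comp_apply] at this

/-- The image of a morphism of adic towers: its terms need not be those of the images, but it is
reached by an epimorphism in each degree. -/
theorem exists_image [∀ X : C, IsNoetherianObject X] {M N : AdicTower J C} (f : M ⟶ N) :
    ∃ (P : AdicTower J C) (p : M ⟶ P) (j : P ⟶ N), p ≫ j = f ∧ (∀ n, Epi (p.hom.app n)) ∧ Mono j ∧
      ∀ {X : AdicTower J C} (g : X ⟶ N), (∀ n, LinearMap.range (E.map (g.hom.app n)).hom ≤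
        LinearMap.range (E.map (f.hom.app n)).hom) → ∃ k, k ≫ j = g := by
  have hepi (n : ℕᵒᵖ) : Epi ((factorThruImage f.hom).app n) := inferInstance
  have hmono (n : ℕᵒᵖ) : Mono ((image.ι f.hom).app n) := inferInstance
  have hfac (n : ℕᵒᵖ) : (factorThruImage f.hom).app n ≫ (image.ι f.hom).app n = f.hom.app n := by
    rw [← NatTrans.comp_app, image.fac]
  have hrange (n : ℕᵒᵖ) : LinearMap.range (E.map ((image.ι f.hom).app n)).hom =
      LinearMap.range (E.map (f.hom.app n)).hom := by
    rw [← hfac, E.map_comp, ModuleCat.hom_comp]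
    exact (LinearMap.range_comp_of_range_eq_top _
      (LinearMap.range_eq_top.2 ((epi_iff_surjective E _).1 (hepi n)))).symm
  obtain ⟨P, hP, j, hj, hker, hlift⟩ := exists_adicSub (E := E) N.property (image.ι f.hom) hmono
    fun {n m} h => by
      have := M.property.epi_towerMap h
      have h1 := epi_comp (towerMap M.obj h) ((factorThruImage f.hom).app (op n))
      rw [(factorThruImage f.hom).naturality] at h1
      exact epi_of_epi ((factorThruImage f.hom).app (op m)) _
  simp only [hrange] at hlift hj
  obtain ⟨p, hp⟩ := hlift M.obj M.property f.hom fun n => le_rfl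
  have hp' (n : ℕᵒᵖ) : p.app n ≫ j.app n = f.hom.app n := by rw [← NatTrans.comp_app, hp]
  refine ⟨⟨P, hP⟩, ObjectProperty.homMk p, ObjectProperty.homMk j, by ext1; exact hp,
    fun ⟨n⟩ => ?_, mono_of_ker_le (E := E) _ hker, fun {X} g hg => ?_⟩
  · refine (epi_iff_surjective E _).2 fun z => ?_
    obtain ⟨m, h, hm⟩ := hker n
    obtain ⟨z, rfl⟩ := hP.surjective h z
    have hz : E.map (j.app (op m)) z ∈ LinearMap.range (E.map (f.hom.app (op m))).hom := by
      rw [← hj]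
      exact ⟨z, rfl⟩
    obtain ⟨x, hx⟩ := hz
    have h0 : z - E.map (p.app (op m)) x ∈ LinearMap.ker (E.map (j.app (op m))).hom := by
      rw [LinearMap.mem_ker, map_sub, sub_eq_zero]
      refine hx.symm.trans ?_
      change E.map _ x = E.map _ (E.map _ x)
      rw [← map_comp_apply, hp']
    have h1 : E.map (towerMap P h) (z - E.map (p.app (op m)) x) = 0 := hm h0
    refine ⟨E.map (towerMap M.obj h) x, ?_⟩
    rw [map_sub, sub_eq_zero, ← map_comp_apply, ← p.naturality, map_comp_apply] at h1
    exact h1.symm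
  · obtain ⟨k, hk⟩ := hlift X.obj X.property g.hom hg
    exact ⟨ObjectProperty.homMk k, by ext1; exact hk⟩

/-- The kernel of a morphism of adic towers that is an epimorphism in each degree. -/
theorem exists_kernel_of_epi [∀ X : C, IsNoetherianObject X] {M Q : AdicTower J C} (e : M ⟶ Q)
    (he : ∀ n, Epi (e.hom.app n)) :
    ∃ (P : AdicTower J C) (j : P ⟶ M), Mono j ∧ j ≫ e = 0 ∧
      (∀ n, LinearMap.range (E.map (j.hom.app n)).hom = LinearMap.ker (E.map (e.hom.app n)).hom) ∧
      ∀ {X : AdicTower J C} (g : X ⟶ M), g ≫ e = 0 → ∃ k, k ≫ j = g := by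
  have hmono (n : ℕᵒᵖ) : Mono ((kernel.ι e.hom).app n) := inferInstance
  have hrange (n : ℕᵒᵖ) : LinearMap.range (E.map ((kernel.ι e.hom).app n)).hom =
      LinearMap.ker (E.map (e.hom.app n)).hom :=
    IsExactEmbedding.range_eq_ker
      ((ShortComplex.exact_kernel e.hom).map ((evaluation ℕᵒᵖ C).obj n))
  have hinj (n : ℕᵒᵖ) := (mono_iff_injective E _).1 (hmono n)
  obtain ⟨P, hP, j, hj, hker, hlift⟩ := exists_adicSub (E := E) M.property (kernel.ι e.hom) hmono
    fun {n m} h => by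
      refine (epi_iff_surjective E _).2 fun x => ?_
      obtain ⟨y, hy⟩ := M.property.surjective h (E.map ((kernel.ι e.hom).app (op n)) x)
      have hx : E.map (e.hom.app (op n)) (E.map ((kernel.ι e.hom).app (op n)) x) = 0 := by
        have : E.map ((kernel.ι e.hom).app (op n)) x ∈
            LinearMap.ker (E.map (e.hom.app (op n))).hom := by
          rw [← hrange]
          exact ⟨x, rfl⟩
        exact this
      have h1 : E.map (e.hom.app (op m)) y ∈ LinearMap.ker (E.map (towerMap Q.obj h)).hom := by
        change E.map (towerMap Q.obj h) _ = 0
        rw [← map_comp_apply, ← e.hom.naturality, map_comp_apply, hy, hx]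
      have htop : Submodule.map (E.map (e.hom.app (op m))).hom ⊤ = ⊤ := by
        rw [Submodule.map_top]
        exact LinearMap.range_eq_top.2 ((epi_iff_surjective E _).1 (he _))
      rw [Q.property.ker_eq, ← htop, ← Submodule.map_smul''] at h1
      obtain ⟨y', hy', hyy'⟩ := h1
      rw [← M.property.ker_eq h] at hy'
      have h2 : y - y' ∈ LinearMap.range (E.map ((kernel.ι e.hom).app (op m))).hom := by
        rw [hrange, LinearMap.mem_ker, map_sub, sub_eq_zero]
        exact hyy'.symm
      obtain ⟨z, hz⟩ := h2
      refine ⟨z, hinj _ ?_⟩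
      rw [← map_comp_apply, (kernel.ι e.hom).naturality, map_comp_apply]
      refine (congrArg _ hz).trans ?_
      rw [map_sub, hy]
      exact sub_eq_self.2 hy'
  simp only [hrange] at hlift hj
  refine ⟨⟨P, hP⟩, ObjectProperty.homMk j, mono_of_ker_le (E := E) _ hker, ?_, hj,
    fun {X} g hg => ?_⟩
  · ext n
    refine (map_eq_zero_iff E _).1 fun x => ?_
    have : E.map (j.app n) x ∈ LinearMap.ker (E.map (e.hom.app n)).hom := by
      rw [← hj]
      exact ⟨x, rfl⟩
    exact (map_comp_apply (j.app n) (e.hom.app n) x).trans this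
  · obtain ⟨k, hk⟩ := hlift X.obj X.property g.hom fun n => by
      rintro _ ⟨x, rfl⟩
      have h0 : g.hom.app n ≫ e.hom.app n = 0 :=
        comp_app_eq_zero hg n
      have := (map_eq_zero_iff E _).2 h0 x
      rwa [map_comp_apply] at this
    exact ⟨ObjectProperty.homMk k, by ext1; exact hk⟩

theorem isAdicTower_cokernel {M N : AdicTower J C} (f : M ⟶ N) :
    isAdicTower J C (cokernel f.hom) := by
  obtain ⟨E, _⟩ := exists_isExactEmbedding R C
  have hπ (n : ℕᵒᵖ) : Epi ((cokernel.π f.hom).app n) := inferInstance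
  have hπs (n : ℕᵒᵖ) := (epi_iff_surjective E _).1 (hπ n)
  have hrange (n : ℕᵒᵖ) : LinearMap.range (E.map (f.hom.app n)).hom =
      LinearMap.ker (E.map ((cokernel.π f.hom).app n)).hom :=
    IsExactEmbedding.range_eq_ker
      ((ShortComplex.exact_cokernel f.hom).map ((evaluation ℕᵒᵖ C).obj n))
  rintro ⟨n⟩ ⟨m⟩ a
  have h : n ≤ m := leOfHom a.unop
  change IsReduction (J ^ n) (towerMap _ h)
  have nat := (cokernel.π f.hom).naturality (homOfLE h).op
  have : Epi (towerMap (cokernel f.hom) h) := by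
    have := N.property.epi_towerMap h
    have h1 := epi_comp (towerMap N.obj h) ((cokernel.π f.hom).app (op n))
    rw [nat] at h1
    exact epi_of_epi ((cokernel.π f.hom).app (op m)) _
  refine isReduction_of_ker E _ (le_antisymm ?_ (Submodule.smul_le.2 fun r hr x _ => ?_))
  · intro z hz
    obtain ⟨y, rfl⟩ := hπs _ z
    have hy : E.map (towerMap N.obj h) y ∈ LinearMap.range (E.map (f.hom.app (op n))).hom := by
      rw [hrange]
      change E.map ((cokernel.π f.hom).app (op n)) _ = 0
      rw [← map_comp_apply, nat, map_comp_apply]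
      exact hz
    obtain ⟨x, hx⟩ := hy
    obtain ⟨x, rfl⟩ := M.property.surjective h x
    have h1 : y - E.map (f.hom.app (op m)) x ∈ LinearMap.ker (E.map (towerMap N.obj h)).hom := by
      rw [LinearMap.mem_ker, map_sub, sub_eq_zero]
      refine hx.symm.trans ?_
      change E.map _ (E.map _ x) = E.map _ (E.map _ x)
      rw [← map_comp_apply, ← map_comp_apply, f.hom.naturality]
    rw [N.property.ker_eq] at h1
    have h2 := Submodule.smul_top_le_comap_smul_top _ (E.map ((cokernel.π f.hom).app (op m))).hom h1
    have h3 : E.map ((cokernel.π f.hom).app (op m)) (E.map (f.hom.app (op m)) x) = 0 := by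
      have : E.map (f.hom.app (op m)) x ∈
          LinearMap.ker (E.map ((cokernel.π f.hom).app (op m))).hom := by
        rw [← hrange]
        exact ⟨x, rfl⟩
      exact this
    rw [Submodule.mem_comap, map_sub] at h2
    rwa [show (E.map ((cokernel.π f.hom).app (op m))).hom _ = 0 from h3, sub_zero] at h2
  · obtain ⟨y, rfl⟩ := hπs _ x
    rw [LinearMap.mem_ker, map_smul]
    change r • E.map (towerMap _ h) (E.map _ y) = 0
    rw [← map_comp_apply, ← nat, map_comp_apply, ← map_smul, N.property.smul_eq_zero hr, map_zero]

omit [IsNoetherianRing R] in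
theorem isIso_of_isIso_app {M N : AdicTower J C} (e : M ⟶ N) (h : ∀ n, IsIso (e.hom.app n)) :
    IsIso e := by
  have : IsIso e.hom := NatIso.isIso_of_isIso_app _
  exact (ObjectProperty.isIso_hom_iff e).1 this

instance [∀ X : C, IsNoetherianObject X] : HasKernels (AdicTower J C) where
  has_limit {M N} f := by
    obtain ⟨E, _⟩ := exists_isExactEmbedding R C
    obtain ⟨Q, p, i, rfl, hp, hi, -⟩ := exists_image (E := E) f
    obtain ⟨P, j, hj, hj0, -, hl⟩ := exists_kernel_of_epi (E := E) p hp
    have : HasLimit (parallelPair p 0) := HasLimit.mk ⟨KernelFork.ofι j hj0,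
      Fork.IsLimit.mk' _ fun s => ⟨(hl s.ι (KernelFork.condition s)).choose,
        (hl s.ι (KernelFork.condition s)).choose_spec, fun {m} hm => by
          rw [← cancel_mono j]
          exact hm.trans (hl s.ι (KernelFork.condition s)).choose_spec.symm⟩⟩
    exact hasKernel_comp_mono p i

/-- Cokernels of adic towers are formed degreewise. -/
def cokernelCofork {M N : AdicTower J C} (f : M ⟶ N) : CokernelCofork f :=
  CokernelCofork.ofπ (Z := ⟨cokernel f.hom, isAdicTower_cokernel f⟩)
    (ObjectProperty.homMk (cokernel.π f.hom)) (by
      ext1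
      exact cokernel.condition f.hom)

/-- The degreewise cokernel is a cokernel in the category of adic towers. -/
def isColimitCokernelCofork {M N : AdicTower J C} (f : M ⟶ N) : IsColimit (cokernelCofork f) :=
  Cofork.IsColimit.mk' _ fun s => by
    refine ⟨ObjectProperty.homMk (cokernel.desc f.hom s.π.hom
      ((isAdicTower J C).ι.congr_map (CokernelCofork.condition s))), ?_, fun {m} hm => ?_⟩
    · ext1
      exact cokernel.π_desc _ _ _
    · ext1
      refine (cancel_epi (cokernel.π f.hom)).1 ?_
      exact ((isAdicTower J C).ι.congr_map hm).trans (cokernel.π_desc _ _ _).symm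

instance : HasCokernels (AdicTower J C) where
  has_colimit f := HasColimit.mk ⟨_, isColimitCokernelCofork f⟩

theorem epi_app_of_epi {M N : AdicTower J C} (f : M ⟶ N) [Epi f] (n : ℕᵒᵖ) :
    Epi (f.hom.app n) := by
  have h0 : (cokernelCofork f).π = 0 := by
    rw [← cancel_epi f, CokernelCofork.condition, comp_zero]
  have h1 : cokernel.π f.hom = 0 := (isAdicTower J C).ι.congr_map h0
  have : Epi f.hom := Preadditive.epi_of_cokernel_zero h1
  infer_instance

/-- A monomorphism of adic towers need not be one in each degree; nevertheless factorizations
through it can be tested degreewise. -/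
theorem exists_lift_of_mono [∀ X : C, IsNoetherianObject X] {M N X : AdicTower J C} (i : M ⟶ N)
    [Mono i] (g : X ⟶ N) (hg : ∀ n, LinearMap.range (E.map (g.hom.app n)).hom ≤
        LinearMap.range (E.map (i.hom.app n)).hom) : ∃ k, k ≫ i = g := by
  obtain ⟨P, p, j, hpj, hp, hj, hl⟩ := exists_image (E := E) i
  obtain ⟨K, q, -, hq, hr, -⟩ := exists_kernel_of_epi (E := E) p hp
  have hq0 : q = 0 := by
    rw [← cancel_mono i, ← hpj, reassoc_of% hq, zero_comp, zero_comp]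
  have : IsIso p := isIso_of_isIso_app p fun n => by
    have := hp n
    have : Mono (p.hom.app n) := by
      refine (mono_iff_injective E _).2 (LinearMap.ker_eq_bot.1 ((hr n).symm.trans ?_))
      rw [hq0]
      change LinearMap.range (E.map (0 : K.obj.obj n ⟶ M.obj.obj n)).hom = ⊥
      rw [E.map_zero]
      exact LinearMap.range_zero
    exact isIso_of_mono_of_epi _
  obtain ⟨k, hk⟩ := hl g hg
  exact ⟨k ≫ inv p, by rw [← hk, ← hpj]; simp⟩

theorem isNormalMono_of_mono [∀ X : C, IsNoetherianObject X] {M N : AdicTower J C} (i : M ⟶ N)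
    [Mono i] : Nonempty (NormalMono i) := by
  obtain ⟨E, _⟩ := exists_isExactEmbedding R C
  have hl (s : Fork (cokernelCofork i).π 0) : ∃ k, k ≫ i = s.ι := by
    refine exists_lift_of_mono (E := E) i s.ι fun n => ?_
    have hrange : LinearMap.range (E.map (i.hom.app n)).hom =
        LinearMap.ker (E.map ((cokernel.π i.hom).app n)).hom :=
      IsExactEmbedding.range_eq_ker
        ((ShortComplex.exact_cokernel i.hom).map ((evaluation ℕᵒᵖ C).obj n))
    rw [hrange]
    rintro _ ⟨x, rfl⟩
    have h0 : s.ι.hom.app n ≫ (cokernel.π i.hom).app n = 0 :=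
      comp_app_eq_zero (KernelFork.condition s) n
    have := (map_eq_zero_iff E _).2 h0 x
    rwa [map_comp_apply] at this
  exact ⟨⟨_, (cokernelCofork i).π, CokernelCofork.condition _, Fork.IsLimit.mk' _ fun s =>
    ⟨(hl s).choose, (hl s).choose_spec, fun {m} hm => by
      rw [← cancel_mono i]
      exact hm.trans (hl s).choose_spec.symm⟩⟩⟩

theorem isNormalEpi_of_epi [∀ X : C, IsNoetherianObject X] {M N : AdicTower J C} (e : M ⟶ N)
    [Epi e] : Nonempty (NormalEpi e) := by
  obtain ⟨E, _⟩ := exists_isExactEmbedding R C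
  have he (n : ℕᵒᵖ) := epi_app_of_epi e n
  obtain ⟨P, j, -, hj0, hr, -⟩ := exists_kernel_of_epi (E := E) e he
  have hd (s : Cofork j 0) : ∃ k, e ≫ k = s.π := by
    have (n : ℕᵒᵖ) : ∃ k, e.hom.app n ≫ k = s.π.hom.app n := by
      refine exists_desc E _ _ ?_
      rw [← hr]
      rintro _ ⟨x, rfl⟩
      have h0 : j.hom.app n ≫ s.π.hom.app n = 0 :=
        comp_app_eq_zero (CokernelCofork.condition s) n
      have := (map_eq_zero_iff E _).2 h0 x
      rwa [map_comp_apply] at this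
    choose k hk using this
    refine ⟨ObjectProperty.homMk ⟨k, fun n m a => ?_⟩, ?_⟩
    · have := he n
      rw [← cancel_epi (e.hom.app n), ← e.hom.naturality_assoc, hk, reassoc_of% (hk n)]
      exact s.π.hom.naturality a
    · ext n
      exact hk n
  exact ⟨⟨P, j, hj0, Cofork.IsColimit.mk' _ fun s =>
    ⟨(hd s).choose, (hd s).choose_spec, fun {m} hm => by
      rw [← cancel_epi e]
      exact hm.trans (hd s).choose_spec.symm⟩⟩⟩

omit [IsNoetherianRing R] in
theorem isAdicTower_biprod (M N : AdicTower J C) : isAdicTower J C (M.obj ⊞ N.obj) := by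
  intro n m a
  let P := M.obj ⊞ N.obj
  have total (k : ℕᵒᵖ) : (biprod.fst : P ⟶ M.obj).app k ≫ (biprod.inl : M.obj ⟶ P).app k +
      (biprod.snd : P ⟶ N.obj).app k ≫ (biprod.inr : N.obj ⟶ P).app k = 𝟙 (P.obj k) :=
    NatTrans.congr_app (biprod.total (X := M.obj) (Y := N.obj)) k
  have hl := (biprod.inl : M.obj ⟶ P).naturality a
  have hr := (biprod.inr : N.obj ⟶ P).naturality a
  have hl' := (biprod.fst : P ⟶ M.obj).naturality a
  have hr' := (biprod.snd : P ⟶ N.obj).naturality a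
  have ext {k : ℕᵒᵖ} {X : C} {f g : P.obj k ⟶ X}
      (h1 : (biprod.inl : M.obj ⟶ P).app k ≫ f = (biprod.inl : M.obj ⟶ P).app k ≫ g)
      (h2 : (biprod.inr : N.obj ⟶ P).app k ≫ f = (biprod.inr : N.obj ⟶ P).app k ≫ g) :
      f = g := by
    rw [← Category.id_comp f, ← Category.id_comp g, ← total, Preadditive.add_comp,
      Preadditive.add_comp]
    simp only [Category.assoc, h1, h2]
  have hM := M.property a
  have hN := N.property a
  have : Epi (P.map a) := ⟨fun f g h => ext
    (by
      have := hM.epi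
      rw [← cancel_epi (M.obj.map a), reassoc_of% hl, reassoc_of% hl, h])
    (by
      have := hN.epi
      rw [← cancel_epi (N.obj.map a), reassoc_of% hr, reassoc_of% hr, h])⟩
  refine IsReduction.of_epi (π := P.map a) (fun r h => ext ?_ ?_) fun X f hf => ?_
  · rw [Linear.comp_smul, ← hl, ← Linear.smul_comp, hM.smul_eq_zero r h, zero_comp, comp_zero]
  · rw [Linear.comp_smul, ← hr, ← Linear.smul_comp, hN.smul_eq_zero r h, zero_comp, comp_zero]
  · obtain ⟨g, hg, -⟩ := hM.existsUnique_desc ((biprod.inl : M.obj ⟶ P).app m ≫ f)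
      fun r h => by rw [← Linear.comp_smul, hf r h, comp_zero]
    obtain ⟨g', hg', -⟩ := hN.existsUnique_desc ((biprod.inr : N.obj ⟶ P).app m ≫ f)
      fun r h => by rw [← Linear.comp_smul, hf r h, comp_zero]
    refine ⟨(biprod.fst : P ⟶ M.obj).app n ≫ g + (biprod.snd : P ⟶ N.obj).app n ≫ g', ?_⟩
    rw [Preadditive.comp_add, reassoc_of% hl', reassoc_of% hr', hg, hg', ← Category.assoc,
      ← Category.assoc, ← Preadditive.add_comp, total, Category.id_comp]

instance : HasBinaryBiproducts (AdicTower J C) where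
  has_binary_biproduct M N := by
    let b : BinaryBicone M N :=
      { pt := ⟨M.obj ⊞ N.obj, isAdicTower_biprod M N⟩
        fst := ObjectProperty.homMk biprod.fst
        snd := ObjectProperty.homMk biprod.snd
        inl := ObjectProperty.homMk biprod.inl
        inr := ObjectProperty.homMk biprod.inr
        inl_fst := by ext1; exact biprod.inl_fst
        inl_snd := by ext1; exact biprod.inl_snd
        inr_fst := by ext1; exact biprod.inr_fst
        inr_snd := by ext1; exact biprod.inr_snd }
    exact HasBinaryBiproduct.mk ⟨b, isBinaryBilimitOfTotal b (by ext1; exact biprod.total)⟩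

open scoped ZeroObject in
instance : HasZeroObject (AdicTower J C) := by
  have h : isAdicTower J C 0 := fun n m a => by
    have h0 (k : ℕᵒᵖ) : IsZero ((0 : ℕᵒᵖ ⥤ C).obj k) := (isZero_zero (ℕᵒᵖ ⥤ C)).obj k
    have : IsIso ((0 : ℕᵒᵖ ⥤ C).map a) := ⟨0, (h0 _).eq_of_src _ _, (h0 _).eq_of_src _ _⟩
    exact IsReduction.of_isIso fun r _ => (h0 _).eq_of_src _ _
  refine ⟨⟨0, h⟩, (IsZero.iff_id_eq_zero _).2 ?_⟩
  ext1
  exact (isZero_zero (ℕᵒᵖ ⥤ C)).eq_of_src _ _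

instance : HasFiniteProducts (AdicTower J C) :=
  have : HasTerminal (AdicTower J C) := HasZeroObject.hasTerminal
  hasFiniteProducts_of_has_binary_and_terminal

/-! ### The completion is abelian and noetherian -/

theorem isAbelian_completion [∀ X : C, IsNoetherianObject X] : IsAbelian (Completion J C) := by
  let a : Abelian (AdicTower J C) :=
    { normalMonoOfMono := fun i _ => isNormalMono_of_mono i
      normalEpiOfEpi := fun e _ => isNormalEpi_of_epi e }
  have : HasFiniteProducts (Completion J C) :=
    ⟨fun _ => Adjunction.hasLimitsOfShape_of_equivalence (limTower J C).inv⟩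
  exact ⟨abelianOfEquivalence (limTower J C).inv, rfl⟩

omit [IsNoetherianRing R] in
/-- The images in `N` of the terms of a tower over `N` form a subtower. -/
theorem isSubtower_range {M N : AdicTower J C} (i : M ⟶ N) :
    IsSubtower E N.obj fun n => LinearMap.range (E.map (i.hom.app (op n))).hom := by
  refine ⟨fun n => IsSub.range _, fun n => ?_⟩
  rw [← LinearMap.range_comp, ← ModuleCat.hom_comp, ← E.map_comp, ← i.hom.naturality, E.map_comp,
    ModuleCat.hom_comp]
  exact LinearMap.range_comp_of_range_eq_top _
    (LinearMap.range_eq_top.2 (M.property.surjective n.le_succ))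

instance [∀ X : C, IsNoetherianObject X] (N : AdicTower J C) : IsNoetherianObject N := by
  obtain ⟨E, _⟩ := exists_isExactEmbedding R C
  rw [isNoetherianObject_iff_monotone_chain_condition]
  intro f
  let u : ℕ →o ∀ n : ℕ, Submodule R (E.obj (N.obj.obj (op n))) :=
    { toFun k n := LinearMap.range (E.map ((f k).arrow.hom.app (op n))).hom
      monotone' k l h n := by
        have := NatTrans.congr_app ((isAdicTower J C).ι.congr_map
          (Subobject.ofLE_arrow (f.monotone h))) (op n)
        rintro _ ⟨x, rfl⟩
        refine ⟨E.map ((Subobject.ofLE _ _ (f.monotone h)).hom.app (op n)) x, ?_⟩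
        refine (map_comp_apply (E := E) _ _ x).symm.trans ?_
        exact congrArg (fun k => E.map k x) this }
  obtain ⟨n, hn⟩ := exists_forall_eq_of_monotone_subtower N.property u
    fun k => isSubtower_range (f k).arrow
  refine ⟨n, fun m hm => le_antisymm (f.monotone hm) ?_⟩
  obtain ⟨k, hk⟩ := exists_lift_of_mono (E := E) (f n).arrow (f m).arrow
    fun l => (congrFun (hn m hm) l.unop).ge
  exact Subobject.le_of_comm k hk

/-- Being noetherian is reflected by fully faithful functors preserving monomorphisms. -/
theorem isNoetherianObject_of_map {A : Type*} {B : Type*} [Category* A] [Category* B] (F : A ⥤ B)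
    [F.Full] [F.Faithful] [F.PreservesMonomorphisms] (X : A) [IsNoetherianObject (F.obj X)] :
    IsNoetherianObject X := by
  rw [isNoetherianObject_iff_monotone_chain_condition]
  intro f
  obtain ⟨n, hn⟩ := monotone_chain_condition_of_isNoetherianObject
    (⟨fun k => Subobject.mk (F.map (f k).arrow), fun k l h =>
      Subobject.mk_le_mk_of_comm (F.map (Subobject.ofLE _ _ (f.monotone h))) (by
        rw [← F.map_comp, Subobject.ofLE_arrow])⟩ : ℕ →o Subobject (F.obj X))
  refine ⟨n, fun m hm => le_antisymm (f.monotone hm) ?_⟩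
  have h : Subobject.mk (F.map (f m).arrow) ≤ Subobject.mk (F.map (f n).arrow) := (hn m hm).ge
  exact Subobject.le_of_comm (F.preimage (Subobject.ofMkLEMk _ _ h)) (F.map_injective (by simp))

theorem noetherian_completion [Noetherian.{v, u, v} C] :
    Noetherian.{v, max u (v + 1), v} (Completion J C) where
  toEssentiallySmall := by
    have : EssentiallySmall.{v} (ℕᵒᵖ ⥤ C) :=
      EssentiallySmall.mk' (equivSmallModel.{v} C).congrRight
    have : EssentiallySmall.{v} (AdicTower J C) := essentiallySmall_of_fully_faithful
      (isAdicTower J C).ι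
    exact (essentiallySmall_congr (limTower J C).asEquivalence).1 this
  isNoetherianObject X := isNoetherianObject_of_map (limTower J C).inv X

end AbelianTowers

end AdicCompletionCat

end

theorem proposition2p2p12 {R : Type w} [CommRing R] [IsNoetherianRing R] (J : Ideal R)
    (C : Type u) [Category.{v} C] [Abelian C] [Linear R C] [Noetherian.{v, u, v} C] :
    AdicCompletionCat.IsComplete J (AdicCompletionCat.Completion J C) := by
  exact
    { isAbelian := AdicCompletionCat.isAbelian_completion
      noetherian := AdicCompletionCat.noetherian_completion
      hasReductions := inferInstance
      isAdic_toPro := AdicCompletionCat.isAdic_toPro J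
      isEquivalence := AdicCompletionCat.isEquivalence_lift_toPro J _ }
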